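/- **Setting.** A channel autoencoder sends one of $M$ equiprobable messages by an encoder $f:\{1,\dots,M\}\to X^n$ over $n$ uses of a memoryless channel $p(y|x)$, and a decoder $g$ maps the received sequence to $M$ real numbers, to which softmax is applied. The input alphabet $X$ is a closed subset of a finite-dimensional real normed space $E$; $p(\cdot|x)$ is a density with respect to a $\sigma$-finite measure on the output alphabet $Y$, jointly measurable, strictly positive for $x\in X$ and continuous in $x\in X$. With noise power $\sigma^2>0$, an encoder has SNR at most $\gamma$ if every codeword satisfies $\frac1n\sum_j\|x_j\|^2\le\gamma\sigma^2$. The loss is the cross entropy $$J(f,g)=\frac1M\sum_{m=1}^M\mathbb E\big[-\log \mathrm{softmax}(g(y))_m\,\big|\,f(m)\text{ sent}\big],$$ and the error probability is the probability that the sent message is not the unique maximizer of the softmax output. Let $C(\gamma)=\sup I(x;y)$ (bits per channel use) over input laws on $X$ with $\mathbb E\|x\|^2\le\gamma\sigma^2$, and let the minimum required SNR for rate $R\ge 0$ be $\gamma_{\min}(R)=\inf\{\gamma\ge 0: R<C(\gamma)\}$ ($+\infty$ if this set is empty). **Theorem 2.** (a) Let $\gamma>\gamma_{\min}(R)$. For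 all $n\ge 0$ and $M\ge1$ there are an encoder $f$ of SNR at most $\gamma$ and a measurable decoder $g$ that attain the global minimum of $J$ over all such pairs. Moreover, for every $\varepsilon>0$ there is $N$ such that for all $n\ge N$ and all $M\geq 1$ with $\log_2 M\le nR$, every global minimizer has loss at most $\varepsilon$ and error probability at most $\varepsilon$. (b) Consider the one-bit quantized AWGN channel $r=\mathrm{sign}(x+z)$, $z\sim N(0,\sigma^2)$, $\sigma^2>0$, with linear encoder $x=\theta_f\mathbf e_m$ ($\mathbf e_m$ the one-hot encoding of message $m$, $\theta_f\in\mathbb R^{n\times M}$) and, as decoder, a network with parameters $\theta_g$ having one hidden layer of width $w\ge n$ with biases, an arbitrary non-constant activation function $\varphi:\mathbb R\to\mathbb R$ (in particular any nonlinear one), and softmax output. Let $$C(\gamma)=\mathbb E_{\theta\sim N(0,1)}\big[1+Q(\theta\sqrt\gamma)\log_2Q(\theta\sqrt\gamma)+(1-Q(\theta\sqrt\gamma))\log_2(1-Q(\theta\sqrt\gamma))\big],\qquad Q(t)=\int_t^\infty\tfrac1{\sqrt{2\pi}}e^{-s^2/2}\,ds,$$ let $\gamma_{\min}=\min\{\gamma\ge0: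 C(\gamma)=R\}$ and $\gamma>\gamma_{\min}$. For all $n\ge 0$, $M\ge1$, $w\ge n$ and $\varphi$, at least one pair $(\theta_f,\theta_g)$ with $\theta_f$ of SNR at most $\gamma$ attains the global minimum of the loss over all such parameters. Moreover, for every $\varepsilon>0$ there is $N$ such that for all $n\ge N$, all $M\geq 1$ with $\log_2M\le nR$, all $w\ge n$ and all $\varphi$, every global minimizer has loss at most $\varepsilon$ and error probability at most $\varepsilon$. -/

import Mathlib

open MeasureTheory ProbabilityTheory
open scoped ENNReal NNReal

namespace ChannelAE

noncomputable section

section General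

variable {E Y : Type*} [NormedAddCommGroup E] [MeasurableSpace E] [MeasurableSpace Y]

/-- `p` is the transition law `p(y|x)` of a memoryless channel with input alphabet `X ⊆ E` and
output alphabet `Y`: for each input `x ∈ X`, `p x` is a strictly positive probability density with
respect to the reference measure `μ` on `Y` (counting measure for a discrete output, Lebesgue
measure for a continuous one), and it depends continuously on `x`. -/
structure IsChannel (X : Set E) (μ : Measure Y) (p : E → Y → ℝ) : Prop where
  measurable : Measurable (Function.uncurry p)
  pos : ∀ x ∈ X, ∀ y, 0 < p x y
  lintegral_eq_one : ∀ x ∈ X, ∫⁻ y, ENNReal.ofReal (p x y) ∂μ = 1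
  continuousOn : ∀ y, ContinuousOn (fun x => p x y) X

/-- `P` is an admissible law of one channel input: a probability measure on the alphabet `X` with
mean power `𝔼‖x‖²` at most `γ * v`, that is, of SNR at most `γ` when the noise power is `v`. -/
structure IsInputLaw (X : Set E) (v γ : ℝ≥0) (P : Measure E) : Prop where
  isProbabilityMeasure : IsProbabilityMeasure P
  support : P Xᶜ = 0
  power : ∫⁻ x, ‖x‖ₑ ^ 2 ∂P ≤ ((γ * v : ℝ≥0) : ℝ≥0∞)

/-- The joint law of channel input and channel output when the input has law `P`. -/
def jointLaw (μ : Measure Y) (p : E → Y → ℝ) (P : Measure E) : Measure (E × Y) :=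
  (P.prod μ).withDensity fun z => ENNReal.ofReal (p z.1 z.2)

/-- Mutual information, in bits, of channel input and channel output: the Kullback-Leibler
divergence of the joint law from the product of its marginals. -/
def mutualInfo (μ : Measure Y) (p : E → Y → ℝ) (P : Measure E) : ℝ≥0∞ :=
  InformationTheory.klDiv (jointLaw μ p P) ((jointLaw μ p P).fst.prod (jointLaw μ p P).snd) /
    ENNReal.ofReal (Real.log 2)

/-- Capacity (bits per channel use) at SNR `γ`. -/
def capacity (X : Set E) (μ : Measure Y) (p : E → Y → ℝ) (v γ : ℝ≥0) : ℝ≥0∞ :=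
  ⨆ (P : Measure E) (_ : IsInputLaw X v γ P), mutualInfo μ p P

/-- The minimum required SNR for the code rate `R`: the threshold SNR at which the capacity reaches
`R` (it is `⊤` if the capacity exceeds `R` at no SNR). -/
def minSNR (X : Set E) (μ : Measure Y) (p : E → Y → ℝ) (v R : ℝ≥0) : ℝ≥0∞ :=
  sInf {a : ℝ≥0∞ | ∃ γ : ℝ≥0, a = γ ∧ (R : ℝ≥0∞) < capacity X μ p v γ}

/-- The softmax activation function. -/
def softmax {M : ℕ} (u : Fin M → ℝ) (m : Fin M) : ℝ :=
  Real.exp (u m) / ∑ l, Real.exp (u l)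

/-- The law of the length-`n` channel output when the codeword `c` is sent (memoryless channel). -/
def outputLaw {n : ℕ} (μ : Measure Y) (p : E → Y → ℝ) (c : Fin n → E) : Measure (Fin n → Y) :=
  (Measure.pi fun _ => μ).withDensity fun y => ENNReal.ofReal (∏ j, p (c j) (y j))

/-- The loss of the channel autoencoder with encoder `f` and decoder network `g` (followed by
softmax): the cross entropy between the one-hot encoded message and the softmax output, averaged
over the equiprobable messages and over the channel. -/
def loss {n M : ℕ} (μ : Measure Y) (p : E → Y → ℝ)
    (f : Fin M → Fin n → E) (g : (Fin n → Y) → Fin M → ℝ) : ℝ≥0∞ :=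
  (M : ℝ≥0∞)⁻¹ *
    ∑ m, ∫⁻ y, ENNReal.ofReal (-Real.log (softmax (g y) m)) ∂(outputLaw μ p (f m))

/-- The probability that an equiprobable message is not recovered as the unique maximizer of the
softmax output (ties count as errors). -/
def errorProb {n M : ℕ} (μ : Measure Y) (p : E → Y → ℝ)
    (f : Fin M → Fin n → E) (g : (Fin n → Y) → Fin M → ℝ) : ℝ≥0∞ :=
  (M : ℝ≥0∞)⁻¹ *
    ∑ m, outputLaw μ p (f m) {y | ∃ l, l ≠ m ∧ softmax (g y) m ≤ softmax (g y) l}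

/-- The encoder `f` uses symbols of the alphabet `X` and codewords of SNR at most `γ`
(power at most `γ * v` per channel use). -/
def IsEncoder {n M : ℕ} (X : Set E) (v γ : ℝ≥0) (f : Fin M → Fin n → E) : Prop :=
  (∀ m j, f m j ∈ X) ∧ ∀ m, ∑ j, ‖f m j‖ ^ 2 ≤ n * (γ * v : ℝ)

/-- `(f, g)` is a global minimizer of the loss over all encoders of SNR at most `γ` and all
(measurable) decoders. -/
structure IsGlobalMin {n M : ℕ} (X : Set E) (μ : Measure Y) (p : E → Y → ℝ) (v γ : ℝ≥0)
    (f : Fin M → Fin n → E) (g : (Fin n → Y) → Fin M → ℝ) : Prop where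
  encoder : IsEncoder X v γ f
  decoder : Measurable g
  le : ∀ (f' : Fin M → Fin n → E) (g' : (Fin n → Y) → Fin M → ℝ),
    IsEncoder X v γ f' → Measurable g' → loss μ p f g ≤ loss μ p f' g'

end General

section OneBit

/-- One-bit quantization; `true` stands for `+1` and `false` for `-1`. -/
def oneBit (y : ℝ) : Bool := decide (0 ≤ y)

/-- The value `±1` of a one-bit sample. -/
def bitValue (b : Bool) : ℝ := if b then 1 else -1

/-- The transition probabilities of the one-bit quantized AWGN channel with noise variance `v`:
`oneBitChannel v x b` is the probability that `sign (x + z)` is `b`, where `z ∼ N(0, v)`. -/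
def oneBitChannel (v : ℝ≥0) (x : ℝ) (b : Bool) : ℝ :=
  ((gaussianReal 0 v).map fun z => oneBit (x + z)).real {b}

/-- The Gaussian tail function. -/
def Q (t : ℝ) : ℝ := ∫ s in Set.Ioi t, 1 / √(2 * Real.pi) * Real.exp (-s ^ 2 / 2)

/-- The capacity (bits per channel use) at transmit SNR `γ` of the one-bit quantized AWGN channel
autoencoder with standard Gaussian encoder weights. -/
def oneBitCapacity (γ : ℝ≥0) : ℝ :=
  ∫ t, (1 + Q (t * √(γ : ℝ)) * Real.logb 2 (Q (t * √(γ : ℝ)))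
    + (1 - Q (t * √(γ : ℝ))) * Real.logb 2 (1 - Q (t * √(γ : ℝ)))) ∂(gaussianReal 0 1)

/-- The linear encoder with parameters `θ`, applied to the one-hot encoding of the message. -/
def linearEncoder {n M : ℕ} (θ : Matrix (Fin n) (Fin M) ℝ) (m : Fin M) : Fin n → ℝ :=
  θ.mulVec (Pi.single m 1)

/-- The parameters of a decoder network with `n` inputs, one hidden layer of width `w` and `M`
outputs. -/
structure DecoderParams (n w M : ℕ) where
  W₁ : Matrix (Fin w) (Fin n) ℝ
  b₁ : Fin w → ℝ
  W₂ : Matrix (Fin M) (Fin w) ℝ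
  b₂ : Fin M → ℝ

/-- The decoder network with activation function `φ` in the hidden layer (before the softmax),
acting on the one-bit quantized received signal. -/
def decoderNet {n w M : ℕ} (φ : ℝ → ℝ) (θ : DecoderParams n w M) (r : Fin n → Bool) :
    Fin M → ℝ :=
  θ.W₂.mulVec (fun h => φ (θ.W₁.mulVec (fun j => bitValue (r j)) h + θ.b₁ h)) + θ.b₂

/-- The loss of the one-bit quantized AWGN channel autoencoder as a function of its parameters. -/
def oneBitLoss {n w M : ℕ} (φ : ℝ → ℝ) (v : ℝ≥0) (θf : Matrix (Fin n) (Fin M) ℝ)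
    (θg : DecoderParams n w M) : ℝ≥0∞ :=
  loss Measure.count (oneBitChannel v) (linearEncoder θf) (decoderNet φ θg)

/-- The message error probability of the one-bit quantized AWGN channel autoencoder. -/
def oneBitErrorProb {n w M : ℕ} (φ : ℝ → ℝ) (v : ℝ≥0) (θf : Matrix (Fin n) (Fin M) ℝ)
    (θg : DecoderParams n w M) : ℝ≥0∞ :=
  errorProb Measure.count (oneBitChannel v) (linearEncoder θf) (decoderNet φ θg)

/-- The parameters `(θf, θg)` are a global minimizer of the loss over all encoder parameters of SNR
at most `γ` and all decoder parameters. -/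
structure IsOneBitGlobalMin {n w M : ℕ} (φ : ℝ → ℝ) (v γ : ℝ≥0)
    (θf : Matrix (Fin n) (Fin M) ℝ) (θg : DecoderParams n w M) : Prop where
  encoder : IsEncoder Set.univ v γ (linearEncoder θf)
  le : ∀ (θf' : Matrix (Fin n) (Fin M) ℝ) (θg' : DecoderParams n w M),
    IsEncoder Set.univ v γ (linearEncoder θf') → oneBitLoss φ v θf θg ≤ oneBitLoss φ v θf' θg'

end OneBit

end

end ChannelAE

/-! With the loss under a single integral over the received word `y`, the decoder can be optimized
separately at each `y`, and Gibbs' inequality makes the posterior, given by the vector of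
log-likelihoods, optimal (`IsChannel.loss_posteriorDecoder_le`). Only the encoder remains. It ranges
over a compact set on which the loss of the posterior decoder is lower semicontinuous by Fatou's
lemma (`IsChannel.lowerSemicontinuousOn_loss`), so a minimizer exists.

For smallness it is enough to exhibit one good code. If `w m` is the likelihood of the sent message
and `T` that of its competitors together, the posterior costs `w m * log (1 + T / w m)`, at most
`s⁻¹ * w m ^ (1 - s) * T ^ s`. This is Gallager's random coding functional, here bounding the cross
entropy itself. Its average over codewords drawn i.i.d. from an input law, conditioned on the
alphabet and power constraints, is at most a constant times `M ^ s * I ^ n`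
(`IsChannel.exists_isEncoder_loss_le`). Here `I` is the moment of order `1 - s` of the density of
the joint law relative to the product of its marginals. To first order in `s` it is `1 - s * (mutual
information)`, so at smaller rates the bound decays geometrically for a suitable `s`
(`IsChannel.exists_gallager_lt`). Each error costs at least `log 2`, so a small loss forces a small
error probability.

For the one-bit channel, Gaussian inputs have mutual information `oneBitCapacity`, which is strictly
increasing in the SNR, so the general achievability bound applies. Its log-likelihoods are sums of
functions of single bits; a hidden layer of width `n` computes these exactly, so the networks
contain the posterior decoder. -/

namespace ChannelAE

/-! ### Softmax, Gibbs' inequality and the cross entropy of the posterior -/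

section Softmax

variable {M : ℕ}

theorem softmax_pos (hM : 0 < M) (u : Fin M → ℝ) (m : Fin M) : 0 < softmax u m := by
  have : Nonempty (Fin M) := ⟨⟨0, hM⟩⟩
  unfold softmax
  have : 0 < ∑ l, Real.exp (u l) :=
    Finset.sum_pos (fun l _ => Real.exp_pos _) Finset.univ_nonempty
  positivity

theorem sum_softmax (hM : 0 < M) (u : Fin M → ℝ) : ∑ m, softmax u m = 1 := by
  have : Nonempty (Fin M) := ⟨⟨0, hM⟩⟩
  unfold softmax
  have : 0 < ∑ l, Real.exp (u l) :=
    Finset.sum_pos (fun l _ => Real.exp_pos _) Finset.univ_nonempty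
  rw [← Finset.sum_div, div_self this.ne']

theorem softmax_le_one (hM : 0 < M) (u : Fin M → ℝ) (m : Fin M) : softmax u m ≤ 1 := by
  rw [← sum_softmax hM u]
  exact Finset.single_le_sum (fun l _ => (softmax_pos hM u l).le) (Finset.mem_univ m)

theorem neg_log_softmax_nonneg (hM : 0 < M) (u : Fin M → ℝ) (m : Fin M) :
    0 ≤ -Real.log (softmax u m) :=
  neg_nonneg.2 (Real.log_nonpos (softmax_pos hM u m).le (softmax_le_one hM u m))

theorem softmax_log {w : Fin M → ℝ} (hw : ∀ m, 0 < w m) (m : Fin M) :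
    softmax (fun l => Real.log (w l)) m = w m / ∑ l, w l := by
  simp [softmax, Real.exp_log (hw _)]

/-- **Gibbs' inequality** for the weighted cross entropy of a softmax output. -/
theorem sum_neg_log_softmax_log_le (hM : 0 < M) {w : Fin M → ℝ} (hw : ∀ m, 0 < w m)
    (u : Fin M → ℝ) :
    ∑ m, w m * -Real.log (softmax (fun l => Real.log (w l)) m)
      ≤ ∑ m, w m * -Real.log (softmax u m) := by
  have : Nonempty (Fin M) := ⟨⟨0, hM⟩⟩
  have hS : 0 < ∑ l, w l := Finset.sum_pos (fun l _ => hw l) Finset.univ_nonempty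
  set S := ∑ l, w l with hSdef
  -- The correction term comes from `log x ≤ x - 1` and sums to zero over `m`, because the softmax
  -- output sums to one.
  have key : ∀ m, w m * -Real.log (softmax (fun l => Real.log (w l)) m)
      ≤ w m * -Real.log (softmax u m) + (softmax u m * S - w m) := by
    intro m
    rw [softmax_log hw, ← hSdef]
    have hq := softmax_pos hM u m
    have h1 := Real.log_le_sub_one_of_pos (x := softmax u m / (w m / S))
      (div_pos hq (div_pos (hw m) hS))
    rw [Real.log_div hq.ne' (div_pos (hw m) hS).ne'] at h1
    have h2 := mul_le_mul_of_nonneg_left h1 (hw m).le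
    have h3 : w m * (softmax u m / (w m / S) - 1) = softmax u m * S - w m := by
      have := (hw m).ne'
      field_simp
    rw [h3] at h2
    linarith
  refine (Finset.sum_le_sum fun m _ => key m).trans_eq ?_
  rw [Finset.sum_add_distrib, Finset.sum_sub_distrib, ← Finset.sum_mul, sum_softmax hM, one_mul,
    ← hSdef, sub_self, add_zero]

/-- If an entry of the softmax output is not the unique maximum, its cross entropy is at least
`log 2`. -/
theorem log_two_le_neg_log_softmax (hM : 0 < M) {u : Fin M → ℝ} {l m : Fin M} (hlm : l ≠ m)
    (h : softmax u m ≤ softmax u l) : Real.log 2 ≤ -Real.log (softmax u m) := by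
  have h1 : softmax u m + softmax u l ≤ 1 := by
    rw [← sum_softmax hM u, ← Finset.sum_pair hlm.symm]
    exact Finset.sum_le_sum_of_subset_of_nonneg (Finset.subset_univ _)
      fun i _ _ => (softmax_pos hM u i).le
  rw [← Real.log_inv]
  refine Real.log_le_log two_pos ?_
  rw [le_inv_comm₀ two_pos (softmax_pos hM u m)]
  linarith

/-- Subadditivity of `t ↦ t ^ s` gives `(1 + t) ^ s ≤ 1 + t ^ s`; taking logarithms yields the
factor `1 / s`. -/
theorem log_one_add_le_rpow_div {t s : ℝ} (ht : 0 ≤ t) (hs : 0 < s) (hs1 : s ≤ 1) :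
    Real.log (1 + t) ≤ t ^ s / s := by
  have h1 : (1 + t) ^ s ≤ 1 + t ^ s := by
    lift t to ℝ≥0 using ht
    simpa using NNReal.coe_le_coe.2 (NNReal.rpow_add_le_add_rpow 1 t hs.le hs1)
  have h2 : 0 < 1 + t := by linarith
  have h3 : Real.log ((1 + t) ^ s) ≤ t ^ s := by
    refine (Real.log_le_sub_one_of_pos (Real.rpow_pos_of_pos h2 s)).trans ?_
    linarith
  rw [Real.log_rpow h2] at h3
  rw [le_div_iff₀ hs]
  linarith

/-- Gallager's bound on the cross entropy of the posterior distribution. -/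
theorem mul_neg_log_softmax_log_le {w : Fin M → ℝ} (hw : ∀ m, 0 < w m) (m : Fin M)
    {s : ℝ} (hs : 0 < s) (hs1 : s ≤ 1) :
    w m * -Real.log (softmax (fun l => Real.log (w l)) m)
      ≤ s⁻¹ * (w m ^ (1 - s) * (∑ l ∈ Finset.univ.erase m, w l) ^ s) := by
  rw [softmax_log hw, ← Real.log_inv, inv_div, ← Finset.add_sum_erase _ _ (Finset.mem_univ m),
    add_div, div_self (hw m).ne']
  have hT : 0 ≤ ∑ l ∈ Finset.univ.erase m, w l := Finset.sum_nonneg fun l _ => (hw l).le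
  refine (mul_le_mul_of_nonneg_left
    (log_one_add_le_rpow_div (div_nonneg hT (hw m).le) hs hs1) (hw m).le).trans_eq ?_
  rw [Real.div_rpow hT (hw m).le, Real.rpow_sub (hw m), Real.rpow_one]
  ring

end Softmax

theorem lintegral_fin_pi_prod {n : ℕ} {Ω : Type*} [MeasurableSpace Ω] (μ : Measure Ω)
    [SigmaFinite μ] {f : Fin n → Ω → ℝ≥0∞} (hf : ∀ i, Measurable (f i)) :
    ∫⁻ x, ∏ i, f i (x i) ∂(Measure.pi fun _ : Fin n => μ) = ∏ i, ∫⁻ x, f i x ∂μ := by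
  induction n with
  | zero => simp
  | succ n ih =>
    have h := (measurePreserving_piFinSuccAbove (fun _ : Fin (n + 1) => μ) 0).symm
    rw [← h.lintegral_comp (f := fun x => ∏ i, f i (x i))
      (Finset.measurable_fun_prod _ fun i _ => (hf i).comp (measurable_pi_apply i))]
    simp only [MeasurableEquiv.piFinSuccAbove_symm_apply, Fin.insertNthEquiv, Fin.prod_univ_succ,
      Equiv.coe_fn_mk, Fin.insertNth_zero', Fin.cons_zero, Fin.cons_succ]
    rw [← ih fun i => hf i.succ, ← lintegral_prod_mul (hf 0).aemeasurable]
    exact (Finset.measurable_fun_prod _ fun i _ =>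
      (hf i.succ).comp (measurable_pi_apply i)).aemeasurable

/-! ### Optimal decoder and existence of an optimal encoder -/

section Loss

variable {E Y : Type*} [NormedAddCommGroup E] [MeasurableSpace E] [MeasurableSpace Y]
  {n M : ℕ} {X : Set E} {μ : Measure Y} {p : E → Y → ℝ}

/-- The likelihood of the codeword `c` given the received sequence `y`. -/
def likelihood (p : E → Y → ℝ) (c : Fin n → E) (y : Fin n → Y) : ℝ := ∏ j, p (c j) (y j)

/-- The decoder whose softmax output is the posterior distribution of the message. -/
noncomputable def posteriorDecoder (p : E → Y → ℝ) (f : Fin M → Fin n → E) (y : Fin n → Y) :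
    Fin M → ℝ :=
  fun m => Real.log (likelihood p (f m) y)

theorem IsChannel.likelihood_pos (hp : IsChannel X μ p) {c : Fin n → E} (hc : ∀ j, c j ∈ X)
    (y : Fin n → Y) : 0 < likelihood p c y :=
  Finset.prod_pos fun j _ => hp.pos _ (hc j) _

theorem IsChannel.measurable_likelihood (hp : IsChannel X μ p) (c : Fin n → E) :
    Measurable (likelihood p c) :=
  Finset.measurable_prod _ fun j _ => hp.measurable.of_uncurry_left.comp (measurable_pi_apply j)

theorem IsChannel.measurable_posteriorDecoder (hp : IsChannel X μ p) (f : Fin M → Fin n → E) :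
    Measurable (posteriorDecoder p f) :=
  measurable_pi_lambda _ fun m => (hp.measurable_likelihood (f m)).log

theorem measurable_softmax (m : Fin M) : Measurable fun u : Fin M → ℝ => softmax u m := by
  unfold softmax
  fun_prop

/-- All output laws have densities with respect to the same product measure, so the messages can be
summed pointwise in `y`. This is what allows decoders to be compared one received word at a time. -/
theorem IsChannel.loss_eq_lintegral (hp : IsChannel X μ p) (hM : 0 < M) {f : Fin M → Fin n → E}
    (hf : ∀ m j, f m j ∈ X) {g : (Fin n → Y) → Fin M → ℝ} (hg : Measurable g) :
    loss μ p f g = (M : ℝ≥0∞)⁻¹ * ∫⁻ y, ENNReal.ofReal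
      (∑ m, likelihood p (f m) y * -Real.log (softmax (g y) m)) ∂(Measure.pi fun _ => μ) := by
  unfold loss outputLaw
  congr 1
  have hl : ∀ m, Measurable fun y => ENNReal.ofReal (-Real.log (softmax (g y) m)) := fun m =>
    ((measurable_softmax m).comp hg).log.neg.ennreal_ofReal
  calc _ = ∑ m, ∫⁻ y, ENNReal.ofReal (likelihood p (f m) y)
        * ENNReal.ofReal (-Real.log (softmax (g y) m)) ∂(Measure.pi fun _ => μ) := by
        refine Finset.sum_congr rfl fun m _ => ?_
        exact lintegral_withDensity_eq_lintegral_mul _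
          (hp.measurable_likelihood (f m)).ennreal_ofReal (hl m)
    _ = _ := by
        rw [← lintegral_finsetSum (f := fun m y => ENNReal.ofReal (likelihood p (f m) y)
          * ENNReal.ofReal (-Real.log (softmax (g y) m))) _ fun m _ =>
          (hp.measurable_likelihood (f m)).ennreal_ofReal.mul (hl m)]
        refine lintegral_congr fun y => ?_
        rw [ENNReal.ofReal_sum_of_nonneg fun m _ =>
          mul_nonneg (hp.likelihood_pos (hf m) y).le (neg_log_softmax_nonneg hM _ _)]
        exact Finset.sum_congr rfl fun m _ =>
          (ENNReal.ofReal_mul (hp.likelihood_pos (hf m) y).le).symm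

/-- For a fixed encoder, the posterior decoder minimizes the loss. -/
theorem IsChannel.loss_posteriorDecoder_le (hp : IsChannel X μ p) (hM : 0 < M)
    {f : Fin M → Fin n → E} (hf : ∀ m j, f m j ∈ X) {g : (Fin n → Y) → Fin M → ℝ}
    (hg : Measurable g) : loss μ p f (posteriorDecoder p f) ≤ loss μ p f g := by
  rw [hp.loss_eq_lintegral hM hf hg, hp.loss_eq_lintegral hM hf (hp.measurable_posteriorDecoder f)]
  refine mul_le_mul_right (lintegral_mono fun y => ENNReal.ofReal_le_ofReal ?_) _
  exact sum_neg_log_softmax_log_le hM (fun m => hp.likelihood_pos (hf m) y) _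

omit [NormedAddCommGroup E] [MeasurableSpace E] in
/-- The error probability is bounded by the loss. -/
theorem log_two_mul_errorProb_le_loss (hM : 0 < M) (f : Fin M → Fin n → E)
    {g : (Fin n → Y) → Fin M → ℝ} (hg : Measurable g) :
    ENNReal.ofReal (Real.log 2) * errorProb μ p f g ≤ loss μ p f g := by
  unfold loss errorProb
  rw [mul_left_comm, Finset.mul_sum]
  gcongr with m
  refine le_trans ?_ (mul_meas_ge_le_lintegral
    (((measurable_softmax m).comp hg).log.neg.ennreal_ofReal) (ENNReal.ofReal (Real.log 2)))
  gcongr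
  rintro ⟨l, hlm, h⟩
  exact ENNReal.ofReal_le_ofReal (log_two_le_neg_log_softmax hM hlm h)

omit [MeasurableSpace E] in
theorem isCompact_isEncoder [NormedSpace ℝ E] [FiniteDimensional ℝ E] (hX : IsClosed X)
    (v γ : ℝ≥0) : IsCompact {f : Fin M → Fin n → E | IsEncoder X v γ f} := by
  have : ProperSpace E := FiniteDimensional.proper ℝ E
  refine Metric.isCompact_of_isClosed_isBounded ?_ ?_
  · have : {f : Fin M → Fin n → E | IsEncoder X v γ f} =
        (⋂ m, ⋂ j, {f | f m j ∈ X}) ∩ ⋂ m, {f | ∑ j, ‖f m j‖ ^ 2 ≤ n * (γ * v : ℝ)} := by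
      ext f; simp [IsEncoder]
    rw [this]
    refine IsClosed.inter (isClosed_iInter fun m => isClosed_iInter fun j => ?_)
      (isClosed_iInter fun m => isClosed_le (by fun_prop) (by fun_prop))
    exact hX.preimage (by fun_prop)
  · refine (Metric.isBounded_closedBall (x := (0 : Fin M → Fin n → E))
      (r := √(n * (γ * v : ℝ)))).subset fun f hf => ?_
    rw [mem_closedBall_zero_iff, pi_norm_le_iff_of_nonneg (Real.sqrt_nonneg _)]
    intro m
    rw [pi_norm_le_iff_of_nonneg (Real.sqrt_nonneg _)]
    intro j
    refine Real.le_sqrt_of_sq_le ((Finset.single_le_sum (f := fun j => ‖f m j‖ ^ 2)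
      (fun i _ => by positivity) (Finset.mem_univ j)).trans (hf.2 m))

/-- The integrand is nonnegative and continuous in the code for each `y`. Fatou's lemma therefore
suffices, with no dominating function. -/
theorem IsChannel.lowerSemicontinuousOn_loss (hp : IsChannel X μ p) (hM : 0 < M) :
    LowerSemicontinuousOn (fun f : Fin M → Fin n → E => loss μ p f (posteriorDecoder p f))
      {f | ∀ m j, f m j ∈ X} := by
  intro f hf
  refine lowerSemicontinuousWithinAt_iff_le_liminf.2 ?_
  set F : (Fin M → Fin n → E) → (Fin n → Y) → ℝ≥0∞ := fun f y => (M : ℝ≥0∞)⁻¹ * ENNReal.ofReal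
      (∑ m, likelihood p (f m) y * -Real.log (softmax (posteriorDecoder p f y) m)) with hF
  have hM0 : (M : ℝ≥0∞)⁻¹ ≠ ⊤ := by simp [hM.ne']
  have hlm : ∀ (f : Fin M → Fin n → E) m, Measurable fun y =>
      Real.log (softmax (posteriorDecoder p f y) m) := fun f m =>
    ((measurable_softmax m).comp (hp.measurable_posteriorDecoder f)).log
  have hFm : ∀ f, Measurable (F f) := fun f => by
    refine Measurable.const_mul (Measurable.ennreal_ofReal (Finset.measurable_fun_sum _ fun m _ => ?_)) _
    exact (hp.measurable_likelihood _).mul (hlm f m).neg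
  have hloss : ∀ f ∈ {f : Fin M → Fin n → E | ∀ m j, f m j ∈ X},
      loss μ p f (posteriorDecoder p f) = ∫⁻ y, F f y ∂(Measure.pi fun _ => μ) := by
    intro f hf
    rw [hp.loss_eq_lintegral hM hf (hp.measurable_posteriorDecoder f), hF,
      lintegral_const_mul' _ _ hM0]
  have hcont : ∀ y, ContinuousWithinAt (fun f => F f y) {f | ∀ m j, f m j ∈ X} f := by
    intro y
    have hlik : ∀ m, ContinuousWithinAt (fun f : Fin M → Fin n → E => likelihood p (f m) y)
        {f | ∀ m j, f m j ∈ X} f := by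
      intro m
      refine tendsto_finsetProd _ fun j _ => ?_
      exact ContinuousWithinAt.comp (t := X) (g := fun x => p x (y j))
        (f := fun f : Fin M → Fin n → E => f m j)
        (hp.continuousOn (y j) (f m j) (hf m j)) (Continuous.continuousWithinAt (by fun_prop))
        fun f hf => hf m j
    refine ENNReal.Tendsto.const_mul (ENNReal.tendsto_ofReal ?_) (Or.inr hM0)
    refine tendsto_finsetSum _ fun m _ => (hlik m).tendsto.mul (Filter.Tendsto.neg ?_)
    refine Filter.Tendsto.log ?_ (softmax_pos hM _ _).ne'
    have hexp : ∀ l, ContinuousWithinAt (fun f : Fin M → Fin n → E =>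
        Real.exp (posteriorDecoder p f y l)) {f | ∀ m j, f m j ∈ X} f := fun l =>
      ((hlik l).log (hp.likelihood_pos (hf l) y).ne').rexp
    unfold softmax
    refine (hexp m).tendsto.div (tendsto_finsetSum _ fun l _ => (hexp l).tendsto) ?_
    have : Nonempty (Fin M) := ⟨⟨0, hM⟩⟩
    exact (Finset.sum_pos (fun l _ => Real.exp_pos _) Finset.univ_nonempty).ne'
  calc loss μ p f (posteriorDecoder p f)
      = ∫⁻ y, Filter.liminf (fun f' => F f' y) (nhdsWithin f {f | ∀ m j, f m j ∈ X})
          ∂(Measure.pi fun _ => μ) := by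
        rw [hloss f hf]
        have : (nhdsWithin f {f : Fin M → Fin n → E | ∀ m j, f m j ∈ X}).NeBot :=
          mem_closure_iff_nhdsWithin_neBot.1 (subset_closure hf)
        exact lintegral_congr fun y => (hcont y).tendsto.liminf_eq.symm
    _ ≤ Filter.liminf (fun f' => ∫⁻ y, F f' y ∂(Measure.pi fun _ => μ))
          (nhdsWithin f {f | ∀ m j, f m j ∈ X}) := lintegral_liminf_le hFm
    _ = _ := Filter.liminf_congr (by
        filter_upwards [self_mem_nhdsWithin] with f' hf' using (hloss f' hf').symm)

/-- The encoder minimizing the loss of the posterior decoder exists. -/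
theorem IsChannel.exists_isGlobalMin [NormedSpace ℝ E] [FiniteDimensional ℝ E]
    (hX : IsClosed X) (hp : IsChannel X μ p) {v γ : ℝ≥0} (hM : 0 < M) {x : E} (hx : x ∈ X)
    (hxγ : ‖x‖ ^ 2 ≤ (γ * v : ℝ)) :
    ∃ f : Fin M → Fin n → E, IsGlobalMin X μ p v γ f (posteriorDecoder p f) := by
  have hne : {f : Fin M → Fin n → E | IsEncoder X v γ f}.Nonempty := by
    refine ⟨fun _ _ => x, fun _ _ => hx, fun _ => ?_⟩
    simp only [Finset.sum_const, Finset.card_univ, Fintype.card_fin, nsmul_eq_mul]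
    gcongr
  obtain ⟨f, hf, hmin⟩ := LowerSemicontinuousOn.exists_isMinOn hne (isCompact_isEncoder hX v γ)
    ((hp.lowerSemicontinuousOn_loss hM).mono fun f hf => hf.1)
  exact ⟨f, hf, hp.measurable_posteriorDecoder f, fun f' g' hf' hg' =>
    (hmin hf').trans (hp.loss_posteriorDecoder_le hM hf'.1 hg')⟩

end Loss

/-! ### Random coding under alphabet and power constraints -/

section RandomCoding

/-- This averages one summand of Gallager's bound over a random code. After rewriting `x * y ^ s` as
`x ^ (1 - s) * (x * y) ^ s`, Hölder's inequality leaves only expectations of products of two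
codewords' terms, so pairwise independence is enough. -/
theorem lintegral_pi_mul_rpow_sum_le {A : Type*} [MeasurableSpace A] {M : ℕ} (ν : Measure A)
    [IsProbabilityMeasure ν] {a b : A → ℝ≥0∞} (ha : Measurable a) (hb : Measurable b) (m : Fin M)
    {s : ℝ} (hs : 0 ≤ s) (hs1 : s ≤ 1) :
    ∫⁻ f, a (f m) * (∑ l ∈ Finset.univ.erase m, b (f l)) ^ s ∂(Measure.pi fun _ : Fin M => ν)
      ≤ (∫⁻ x, a x ∂ν) * (M * ∫⁻ x, b x ∂ν) ^ s := by
  have heval : ∀ (h : A → ℝ≥0∞), Measurable h → ∀ l,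
      ∫⁻ f, h (f l) ∂(Measure.pi fun _ : Fin M => ν) = ∫⁻ x, h x ∂ν := fun h hh l =>
    (measurePreserving_eval (fun _ : Fin M => ν) l).lintegral_comp hh
  have ham : Measurable fun f : Fin M → A => a (f m) := ha.comp (measurable_pi_apply m)
  have hbm : ∀ l, Measurable fun f : Fin M → A => b (f l) := fun l =>
    hb.comp (measurable_pi_apply l)
  have hT : Measurable fun f : Fin M → A => ∑ l ∈ Finset.univ.erase m, b (f l) :=
    Finset.measurable_fun_sum _ fun l _ => hbm l
  have hpair : ∀ l ∈ Finset.univ.erase m,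
      ∫⁻ f, a (f m) * b (f l) ∂(Measure.pi fun _ : Fin M => ν)
        = (∫⁻ x, a x ∂ν) * ∫⁻ x, b x ∂ν := by
    intro l hl
    have hind := (iIndepFun_pi (μ := fun _ : Fin M => ν) (X := fun _ => id)
      fun _ => aemeasurable_id).indepFun (Finset.ne_of_mem_erase hl).symm
    rw [lintegral_mul_eq_lintegral_mul_lintegral_of_indepFun'' ham.aemeasurable
      (hbm l).aemeasurable (hind.comp ha hb), heval a ha, heval b hb]
  have hsplit : ∀ x y : ℝ≥0∞, x * y ^ s = x ^ (1 - s) * (x * y) ^ s := fun x y => by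
    rw [ENNReal.mul_rpow_of_nonneg _ _ hs, ← mul_assoc,
      ← ENNReal.rpow_add_of_nonneg _ _ (sub_nonneg.2 hs1) hs, sub_add_cancel, ENNReal.rpow_one]
  calc _ = ∫⁻ f, a (f m) ^ (1 - s) * (a (f m) * ∑ l ∈ Finset.univ.erase m, b (f l)) ^ s
        ∂(Measure.pi fun _ : Fin M => ν) := lintegral_congr fun f => hsplit _ _
    _ ≤ (∫⁻ x, a x ∂ν) ^ (1 - s) * ((∫⁻ x, a x ∂ν) * (M * ∫⁻ x, b x ∂ν)) ^ s := by
        refine (ENNReal.lintegral_mul_norm_pow_le ham.aemeasurable (ham.mul hT).aemeasurable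
          (sub_nonneg.2 hs1) hs (sub_add_cancel _ _)).trans ?_
        rw [heval a ha]
        gcongr
        simp only [Pi.mul_apply, Finset.mul_sum]
        rw [lintegral_finsetSum _ fun l _ => ham.fun_mul (hbm l), Finset.sum_congr rfl hpair,
          Finset.sum_const, nsmul_eq_mul, mul_left_comm]
        gcongr
        simp
    _ = _ := (hsplit _ _).symm

variable {E Y : Type*} [NormedAddCommGroup E] [MeasurableSpace E] [MeasurableSpace Y]
  {n M : ℕ} {X : Set E} {μ : Measure Y} {p : E → Y → ℝ} {v γ₀ γ : ℝ≥0} {P : Measure E}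

theorem IsChannel.loss_posteriorDecoder_le_gallager (hp : IsChannel X μ p) (hM : 0 < M)
    {f : Fin M → Fin n → E} (hf : ∀ m j, f m j ∈ X) {s : ℝ} (hs : 0 < s) (hs1 : s ≤ 1) :
    loss μ p f (posteriorDecoder p f) ≤ (M : ℝ≥0∞)⁻¹ * ∫⁻ y, ∑ m, ENNReal.ofReal s⁻¹ *
      ((∏ j, ENNReal.ofReal (p (f m j) (y j))) ^ (1 - s) *
        (∑ l ∈ Finset.univ.erase m, ∏ j, ENNReal.ofReal (p (f l j) (y j))) ^ s)
        ∂(Measure.pi fun _ => μ) := by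
  rw [hp.loss_eq_lintegral hM hf (hp.measurable_posteriorDecoder f)]
  refine mul_le_mul_right (lintegral_mono fun y => ?_) _
  have hpos : ∀ m, 0 < likelihood p (f m) y := fun m => hp.likelihood_pos (hf m) y
  have hof : ∀ m, ∏ j, ENNReal.ofReal (p (f m j) (y j)) = ENNReal.ofReal (likelihood p (f m) y) :=
    fun m => (ENNReal.ofReal_prod_of_nonneg fun j _ => (hp.pos _ (hf m j) _).le).symm
  have h0 : ∀ m, 0 ≤ ∑ l ∈ Finset.univ.erase m, likelihood p (f l) y := fun m =>
    Finset.sum_nonneg fun l _ => (hpos l).le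
  simp only [hof]
  rw [ENNReal.ofReal_sum_of_nonneg fun m _ =>
    mul_nonneg (hpos m).le (neg_log_softmax_nonneg hM _ _)]
  refine Finset.sum_le_sum fun m _ => ?_
  rw [← ENNReal.ofReal_sum_of_nonneg fun l _ => (hpos l).le,
    ENNReal.ofReal_rpow_of_pos (hpos m), ENNReal.ofReal_rpow_of_nonneg (h0 m) hs.le,
    ← ENNReal.ofReal_mul (Real.rpow_nonneg (hpos m).le _),
    ← ENNReal.ofReal_mul (inv_nonneg.2 hs.le)]
  exact ENNReal.ofReal_le_ofReal (mul_neg_log_softmax_log_le hpos m hs hs1)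

omit [NormedAddCommGroup E] in
theorem measurableSet_forall_mem (hX : MeasurableSet X) :
    MeasurableSet {c : Fin n → E | ∀ j, c j ∈ X} := by
  have : {c : Fin n → E | ∀ j, c j ∈ X} = ⋂ j, (fun c => c j) ⁻¹' X := by ext; simp
  exact this ▸ MeasurableSet.iInter fun j => measurable_pi_apply j hX

/-- By Markov's inequality, an i.i.d. codeword satisfies a slightly relaxed power constraint with
probability bounded away from zero. -/
theorem IsInputLaw.le_measure_pi [BorelSpace E] [SecondCountableTopology E]
    (hP : IsInputLaw X v γ₀ P) (hX : MeasurableSet X) (hv : v ≠ 0) (hγ : γ₀ < γ) (hn : 0 < n) :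
    1 - (γ₀ / γ : ℝ≥0∞) ≤ Measure.pi (fun _ : Fin n => P)
      {c | (∀ j, c j ∈ X) ∧ ∑ j, ‖c j‖ₑ ^ 2 ≤ n * (γ * v : ℝ≥0∞)} := by
  have := hP.isProbabilityMeasure
  set Pn := Measure.pi fun _ : Fin n => P with hPn
  have hSm : Measurable fun c : Fin n → E => ∑ j, ‖c j‖ₑ ^ 2 := by fun_prop
  have hγ0 : (γ : ℝ≥0∞) ≠ 0 := by simpa using (pos_of_gt hγ).ne'
  have hv0 : (v : ℝ≥0∞) ≠ 0 := by simpa using hv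
  have hn0 : (n : ℝ≥0∞) ≠ 0 := by simpa using hn.ne'
  have hXn : Pn {c | ∀ j, c j ∈ X}ᶜ = 0 := by
    have : ∀ᵐ c ∂Pn, ∀ j, c j ∈ X := by
      refine ae_all_iff.2 fun j => ?_
      exact (measurePreserving_eval (fun _ : Fin n => P) j).quasiMeasurePreserving.ae
        (mem_ae_iff.2 hP.support)
    exact mem_ae_iff.1 this
  have hmean : ∫⁻ c, ∑ j, ‖c j‖ₑ ^ 2 ∂Pn ≤ n * (γ₀ * v : ℝ≥0∞) := by
    rw [lintegral_finsetSum _ fun j _ => by fun_prop]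
    have : ∀ j : Fin n, ∫⁻ c : Fin n → E, ‖c j‖ₑ ^ 2 ∂Pn ≤ γ₀ * v := fun j => by
      rw [hPn, (measurePreserving_eval (fun _ : Fin n => P) j).lintegral_comp
        (f := fun x : E => ‖x‖ₑ ^ 2) (by fun_prop)]
      simpa using hP.power
    simpa using Finset.sum_le_sum fun j (_ : j ∈ Finset.univ) => this j
  -- Markov's inequality: the mean power is at most `n * γ₀ * v` and the threshold is `n * γ * v`,
  -- so the bound `γ₀ / γ` does not depend on `n`.
  have hbad : Pn {c | (n * (γ * v) : ℝ≥0∞) ≤ ∑ j, ‖c j‖ₑ ^ 2} ≤ γ₀ / γ := by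
    refine (meas_ge_le_lintegral_div hSm.aemeasurable (by positivity) (by finiteness)).trans ?_
    refine (ENNReal.div_le_div_right hmean _).trans_eq ?_
    rw [ENNReal.mul_div_mul_left _ _ hn0 (by finiteness),
      ENNReal.mul_div_mul_right _ _ hv0 (by finiteness)]
  have hAm : MeasurableSet {c : Fin n → E | (∀ j, c j ∈ X) ∧
      ∑ j, ‖c j‖ₑ ^ 2 ≤ n * (γ * v : ℝ≥0∞)} := by
    exact (measurableSet_forall_mem hX).inter (measurableSet_le hSm measurable_const)
  rw [← compl_compl {c : Fin n → E | (∀ j, c j ∈ X) ∧ ∑ j, ‖c j‖ₑ ^ 2 ≤ n * (γ * v : ℝ≥0∞)},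
    prob_compl_eq_one_sub hAm.compl]
  refine tsub_le_tsub_left ?_ _
  calc _ ≤ Pn ({c | ∀ j, c j ∈ X}ᶜ ∪ {c | (n * (γ * v) : ℝ≥0∞) ≤ ∑ j, ‖c j‖ₑ ^ 2}) := by
        refine measure_mono fun c hc => ?_
        by_cases hcX : ∀ j, c j ∈ X
        · exact Or.inr (le_of_lt (not_le.1 fun h => hc ⟨hcX, h⟩))
        · exact Or.inl hcX
    _ ≤ _ := (measure_union_le _ _).trans (by rw [hXn, zero_add]; exact hbad)

/-- **Random coding** with the posterior decoder. -/
theorem IsChannel.exists_isEncoder_loss_le [BorelSpace E] [SecondCountableTopology E]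
    [SigmaFinite μ] (hp : IsChannel X μ p) (hP : IsInputLaw X v γ₀ P) (hX : MeasurableSet X)
    (hv : v ≠ 0) (hγ : γ₀ < γ) (hn : 0 < n) (hM : 0 < M) {s : ℝ} (hs : 0 < s) (hs1 : s ≤ 1) :
    ∃ f : Fin M → Fin n → E, IsEncoder X v γ f ∧ loss μ p f (posteriorDecoder p f) ≤
      ENNReal.ofReal s⁻¹ * ((1 - (γ₀ / γ : ℝ≥0∞))⁻¹ * (M * (1 - (γ₀ / γ : ℝ≥0∞))⁻¹) ^ s) *
      (∫⁻ y, (∫⁻ x, ENNReal.ofReal (p x y) ^ (1 - s) ∂P) *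
        (∫⁻ x, ENNReal.ofReal (p x y) ∂P) ^ s ∂μ) ^ n := by
  have := hP.isProbabilityMeasure
  set A := {c : Fin n → E | (∀ j, c j ∈ X) ∧ ∑ j, ‖c j‖ₑ ^ 2 ≤ n * (γ * v : ℝ≥0∞)} with hA
  set Pn := Measure.pi fun _ : Fin n => P with hPn
  have hκ : 1 - (γ₀ / γ : ℝ≥0∞) ≤ Pn A := hP.le_measure_pi hX hv hγ hn
  set C := (1 - (γ₀ / γ : ℝ≥0∞))⁻¹ with hC
  have hκ0 : 1 - (γ₀ / γ : ℝ≥0∞) ≠ 0 := by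
    rw [← pos_iff_ne_zero, tsub_pos_iff_lt]
    exact ENNReal.div_lt_of_lt_mul (by simpa using hγ)
  have hA0 : Pn A ≠ 0 := fun h => hκ0 (le_zero_iff.1 (h ▸ hκ))
  have hAm : MeasurableSet A := by
    have hSm : Measurable fun c : Fin n → E => ∑ j, ‖c j‖ₑ ^ 2 := by fun_prop
    exact (measurableSet_forall_mem hX).inter (measurableSet_le hSm measurable_const)
  -- Codewords are drawn from the i.i.d. law conditioned on being admissible. Conditioning inflates
  -- integrals by at most the factor `C`, which is independent of `n`.
  set ν := Pn[|A] with hν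
  have : IsProbabilityMeasure ν := cond_isProbabilityMeasure hA0
  have hνle : ∀ h : (Fin n → E) → ℝ≥0∞, ∫⁻ c, h c ∂ν ≤ C * ∫⁻ c, h c ∂Pn := fun h => by
    rw [hν, ProbabilityTheory.cond, lintegral_smul_measure, smul_eq_mul]
    exact mul_le_mul' (ENNReal.inv_le_inv.2 hκ) (setLIntegral_le_lintegral _ _)
  set L : (Fin n → E) → (Fin n → Y) → ℝ≥0∞ := fun c y => ∏ j, ENNReal.ofReal (p (c j) (y j))
    with hL
  have hpm : Measurable fun z : E × Y => ENNReal.ofReal (p z.1 z.2) := hp.measurable.ennreal_ofReal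
  have hpmx : ∀ y, Measurable fun x => ENNReal.ofReal (p x y) := fun y =>
    hpm.comp (f := fun x => (x, y)) (by fun_prop)
  have hLm : Measurable fun z : (Fin n → E) × (Fin n → Y) => L z.1 z.2 :=
    Finset.measurable_fun_prod _ fun j _ => hpm.comp (f := fun z : (Fin n → E) × (Fin n → Y) =>
      (z.1 j, z.2 j)) (by fun_prop)
  have hLfm : ∀ m : Fin M, Measurable fun z : (Fin M → Fin n → E) × (Fin n → Y) =>
      L (z.1 m) z.2 := fun m => hLm.comp (f := fun z : (Fin M → Fin n → E) × (Fin n → Y) =>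
      (z.1 m, z.2)) (by fun_prop)
  have hLc : ∀ y, Measurable fun c => L c y := fun y => hLm.of_uncurry_right
  set G : Fin M → (Fin M → Fin n → E) → (Fin n → Y) → ℝ≥0∞ := fun m f y =>
    L (f m) y ^ (1 - s) * (∑ l ∈ Finset.univ.erase m, L (f l) y) ^ s with hG
  have hGm : ∀ m, Measurable fun z : (Fin M → Fin n → E) × (Fin n → Y) => G m z.1 z.2 := fun m =>
    ((hLfm m).pow_const _).mul ((Finset.measurable_fun_sum _ fun l _ => hLfm l).pow_const _)
  have hΦm : Measurable fun z : (Fin M → Fin n → E) × (Fin n → Y) =>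
      ∑ m, ENNReal.ofReal s⁻¹ * G m z.1 z.2 :=
    Finset.measurable_fun_sum _ fun m _ => (hGm m).const_mul _
  set Φ : (Fin M → Fin n → E) → ℝ≥0∞ := fun f =>
    (M : ℝ≥0∞)⁻¹ * ∫⁻ y, ∑ m, ENNReal.ofReal s⁻¹ * G m f y ∂(Measure.pi fun _ => μ) with hΦ
  have hΦmeas : Measurable Φ := hΦm.lintegral_prod_right'.const_mul _
  have hnull : (Measure.pi fun _ : Fin M => ν) {f | ∀ m, f m ∈ A}ᶜ = 0 := by
    have : ∀ᵐ f ∂(Measure.pi fun _ : Fin M => ν), ∀ m, f m ∈ A := ae_all_iff.2 fun m =>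
      (measurePreserving_eval (fun _ : Fin M => ν) m).quasiMeasurePreserving.ae (ae_cond_mem hAm)
    exact mem_ae_iff.1 this
  -- Almost every code drawn from the conditioned law is admissible, so some admissible code does at
  -- least as well as the average.
  obtain ⟨f, hf, hle⟩ := exists_notMem_null_le_lintegral hΦmeas.aemeasurable hnull
  simp only [Set.mem_compl_iff, not_not, Set.mem_ofPred_eq] at hf
  refine ⟨f, ⟨fun m => (hf m).1, fun m => ?_⟩,
    (hp.loss_posteriorDecoder_le_gallager hM (fun m => (hf m).1) hs hs1).trans (hle.trans ?_)⟩
  · have h := ENNReal.toReal_mono (by finiteness) (hf m).2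
    rw [ENNReal.toReal_sum (fun j _ => by finiteness)] at h
    simpa using h
  set a : Y → ℝ≥0∞ := fun y => ∫⁻ x, ENNReal.ofReal (p x y) ^ (1 - s) ∂P with ha
  set b : Y → ℝ≥0∞ := fun y => ∫⁻ x, ENNReal.ofReal (p x y) ∂P with hb
  have ham : Measurable a := (hpm.pow_const (1 - s)).lintegral_prod_left'
  have hbm : Measurable b := hpm.lintegral_prod_left'
  have hGint : ∀ m y, ∫⁻ f, G m f y ∂(Measure.pi fun _ : Fin M => ν) ≤
      C * (M * C) ^ s * ∏ j, a (y j) * b (y j) ^ s := by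
    intro m y
    refine (lintegral_pi_mul_rpow_sum_le ν ((hLc y).pow_const (1 - s)) (hLc y) m
      hs.le hs1).trans ?_
    have h1 : ∫⁻ c, L c y ^ (1 - s) ∂ν ≤ C * ∏ j, a (y j) := by
      refine (hνle _).trans_eq ?_
      rw [ha, hPn, ← lintegral_fin_pi_prod P
        (f := fun j x => ENNReal.ofReal (p x (y j)) ^ (1 - s))
        fun j => (hpmx (y j)).pow_const _]
      simp only [hL, ENNReal.prod_rpow_of_nonneg (sub_nonneg.2 hs1)]
    have h2 : ∫⁻ c, L c y ∂ν ≤ C * ∏ j, b (y j) := by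
      refine (hνle _).trans_eq ?_
      rw [hb, hPn, ← lintegral_fin_pi_prod P (f := fun j x => ENNReal.ofReal (p x (y j)))
        fun j => hpmx (y j)]
    calc _ ≤ (C * ∏ j, a (y j)) * (M * (C * ∏ j, b (y j))) ^ s := by gcongr
      _ = _ := by
        rw [← mul_assoc (M : ℝ≥0∞), ENNReal.mul_rpow_of_nonneg _ _ hs.le,
          ← ENNReal.prod_rpow_of_nonneg hs.le, Finset.prod_mul_distrib]
        ring
  have hM0 : (M : ℝ≥0∞) ≠ 0 := by simpa using hM.ne'
  calc ∫⁻ f, Φ f ∂(Measure.pi fun _ : Fin M => ν)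
      = (M : ℝ≥0∞)⁻¹ * ∫⁻ y, ∫⁻ f, ∑ m, ENNReal.ofReal s⁻¹ * G m f y
          ∂(Measure.pi fun _ : Fin M => ν) ∂(Measure.pi fun _ => μ) := by
        rw [hΦ, lintegral_const_mul _ hΦm.lintegral_prod_right', lintegral_lintegral_swap
          hΦm.aemeasurable]
    _ = (M : ℝ≥0∞)⁻¹ * ∫⁻ y, ∑ m, ENNReal.ofReal s⁻¹ * ∫⁻ f, G m f y
          ∂(Measure.pi fun _ : Fin M => ν) ∂(Measure.pi fun _ => μ) := by
        congr 1
        refine lintegral_congr fun y => ?_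
        rw [lintegral_finsetSum _ fun m _ => ((hGm m).of_uncurry_right (y := y)).const_mul _]
        exact Finset.sum_congr rfl fun m _ =>
          lintegral_const_mul _ ((hGm m).of_uncurry_right (y := y))
    _ ≤ (M : ℝ≥0∞)⁻¹ * ∫⁻ y, ∑ _m : Fin M, ENNReal.ofReal s⁻¹ *
          (C * (M * C) ^ s * ∏ j, a (y j) * b (y j) ^ s) ∂(Measure.pi fun _ => μ) := by
        gcongr with y m
        exact hGint m y
    _ = (M : ℝ≥0∞)⁻¹ * (M * (ENNReal.ofReal s⁻¹ *
          (C * (M * C) ^ s * ∏ _j : Fin n, ∫⁻ y, a y * b y ^ s ∂μ))) := by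
        rw [← lintegral_fin_pi_prod μ (f := fun _ y => a y * b y ^ s)
          fun _ => ham.mul (hbm.pow_const _)]
        have hm : Measurable fun y : Fin n → Y => ∏ j, a (y j) * b (y j) ^ s := by fun_prop
        simp only [Finset.sum_const, Finset.card_univ, Fintype.card_fin, nsmul_eq_mul]
        rw [lintegral_const_mul _ ((hm.const_mul _).const_mul _),
          lintegral_const_mul _ (hm.const_mul _), lintegral_const_mul _ hm]
    _ = _ := by
        rw [← mul_assoc, ENNReal.inv_mul_cancel hM0 (by finiteness), one_mul, Finset.prod_const,
          Finset.card_univ, Fintype.card_fin, ← mul_assoc]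

end RandomCoding

/-! ### Positivity of the exponent below the divergence -/

section Exponent

open InformationTheory Filter Topology

/-- The difference quotient of `s ↦ t ^ (1 - s)` at `0` tends to `-(t * log t)`. Subtracting `t - 1`
turns the limit into `klFun t` and, by `rpow_one_sub_le`, makes the terms nonnegative when `t ≥ 0`.
-/
theorem tendsto_sub_rpow_div {t : ℝ} (ht : 0 < t) :
    Tendsto (fun k : ℕ => (t - t ^ (1 - 1 / ((k : ℝ) + 1))) / (1 / ((k : ℝ) + 1)) - (t - 1)) atTop
      (𝓝 (klFun t)) := by
  have hd : HasDerivAt (fun s : ℝ => t ^ (1 - s)) (-(t * Real.log t)) 0 := by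
    have h := ((hasDerivAt_id (0 : ℝ)).const_sub 1).const_rpow ht
    simpa [mul_comm] using h
  have h1 : Tendsto (fun k : ℕ => 1 / ((k : ℝ) + 1)) atTop (𝓝[≠] 0) :=
    tendsto_nhdsWithin_iff.2 ⟨tendsto_one_div_add_atTop_nhds_zero_nat,
      Eventually.of_forall fun k => (by positivity : 1 / ((k : ℝ) + 1) ≠ 0)⟩
  have h2 := ((hd.tendsto_slope_zero.comp h1).neg).sub_const (t - 1)
  rw [neg_neg, show t * Real.log t - (t - 1) = klFun t by rw [klFun_apply]; ring] at h2
  refine h2.congr fun k => ?_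
  simp only [Function.comp_apply, zero_add, sub_zero, Real.rpow_one, smul_eq_mul]
  rw [div_eq_inv_mul]
  ring

theorem rpow_one_sub_le {t s : ℝ} (ht : 0 ≤ t) (hs : 0 ≤ s) (hs1 : s ≤ 1) :
    t ^ (1 - s) ≤ (1 - s) * t + s := by
  simpa using Real.geom_mean_le_arith_mean2_weighted (sub_nonneg.2 hs1) hs ht zero_le_one
    (sub_add_cancel 1 s)

/-- If the divergence of the density `h` exceeds `r`, then its Hölder moments of exponent slightly
below one decay exponentially with rate better than `r`. -/
theorem exists_lintegral_rpow_lt {Z : Type*} [MeasurableSpace Z] {ν : Measure Z}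
    [IsProbabilityMeasure ν] {h : Z → ℝ} (hm : Measurable h) (h0 : ∀ z, 0 ≤ h z)
    (hpos : ∀ᵐ z ∂ν, 0 < h z) (h1 : ∫⁻ z, ENNReal.ofReal (h z) ∂ν = 1) {r : ℝ}
    (hr : ENNReal.ofReal r < ∫⁻ z, ENNReal.ofReal (klFun (h z)) ∂ν) :
    ∃ s : ℝ, 0 < s ∧ s ≤ 1 ∧
      ∫⁻ z, ENNReal.ofReal (h z ^ (1 - s)) ∂ν < ENNReal.ofReal (Real.exp (-(s * r))) := by
  set F : ℕ → Z → ℝ := fun k z =>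
    (h z - h z ^ (1 - 1 / ((k : ℝ) + 1))) / (1 / ((k : ℝ) + 1)) - (h z - 1) with hF
  -- Nonnegativity allows Fatou's lemma, so the argument also covers an infinite divergence.
  have hlim : ∫⁻ z, ENNReal.ofReal (klFun (h z)) ∂ν ≤
      liminf (fun k => ∫⁻ z, ENNReal.ofReal (F k z) ∂ν) atTop := by
    refine le_trans (le_of_eq (lintegral_congr_ae ?_))
      (lintegral_liminf_le fun k => Measurable.ennreal_ofReal (by fun_prop))
    filter_upwards [hpos] with z hz
    exact ((ENNReal.continuous_ofReal.tendsto _).comp (tendsto_sub_rpow_div hz)).liminf_eq.symm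
  obtain ⟨k, hk⟩ := (eventually_lt_of_lt_liminf (hr.trans_le hlim)).exists
  set s : ℝ := 1 / ((k : ℝ) + 1) with hs
  have hs0 : 0 < s := by positivity
  have hs1 : s ≤ 1 := by
    rw [hs, div_le_one (by positivity)]
    linarith [(Nat.cast_nonneg k : (0 : ℝ) ≤ k)]
  have hint : Integrable h ν := by
    refine (lintegral_ofReal_ne_top_iff_integrable hm.aestronglyMeasurable
      (Eventually.of_forall h0)).1 (by simp [h1])
  have hint_eq : ∫ z, h z ∂ν = 1 := by
    rw [integral_eq_lintegral_of_nonneg_ae (Eventually.of_forall h0) hm.aestronglyMeasurable, h1]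
    simp
  have hints : Integrable (fun z => h z ^ (1 - s)) ν := by
    refine ((hint.const_mul (1 - s)).add (integrable_const s)).mono'
      (hm.pow_const _).aestronglyMeasurable (Eventually.of_forall fun z => ?_)
    rw [Real.norm_of_nonneg (Real.rpow_nonneg (h0 z) _)]
    exact rpow_one_sub_le (h0 z) hs0.le hs1
  have hdiv : Integrable (fun z => (h z - h z ^ (1 - s)) / s) ν := (hint.sub hints).div_const s
  have hsub : Integrable (fun z => h z - 1) ν := hint.sub (integrable_const 1)
  have hFint : Integrable (F k) ν := hdiv.sub hsub
  have hF0 : ∀ z, 0 ≤ F k z := fun z => by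
    have := rpow_one_sub_le (h0 z) hs0.le hs1
    simp only [hF, ← hs]
    rw [sub_nonneg, le_div_iff₀ hs0]
    linarith
  rw [← ofReal_integral_eq_lintegral_ofReal hFint (Eventually.of_forall hF0)] at hk
  -- The term `h - 1` has integral zero, so only the Hölder moment survives; `1 - s * r ≤ exp (-(s *
  -- r))` then finishes the proof.
  have hFeq : ∫ z, F k z ∂ν = (1 - ∫ z, h z ^ (1 - s) ∂ν) / s := by
    simp only [hF, ← hs]
    rw [integral_sub hdiv hsub, integral_div, integral_sub hint hints, integral_sub hint (integrable_const 1), hint_eq]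
    simp
  refine ⟨s, hs0, hs1, ?_⟩
  rw [← ofReal_integral_eq_lintegral_ofReal hints
    (Eventually.of_forall fun z => Real.rpow_nonneg (h0 z) _)]
  refine (ENNReal.ofReal_lt_ofReal_iff (Real.exp_pos _)).2 ?_
  have hr' : r < (1 - ∫ z, h z ^ (1 - s) ∂ν) / s := hFeq ▸ (ENNReal.ofReal_lt_ofReal_iff'.1 hk).1
  rw [lt_div_iff₀ hs0] at hr'
  have := Real.add_one_le_exp (-(s * r))
  linarith

end Exponent

/-! ### Mutual information as an integral, and Gallager's exponent -/

section MutualInformation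

open InformationTheory

variable {E Y : Type*} [NormedAddCommGroup E] [MeasurableSpace E] [MeasurableSpace Y]
  {X : Set E} {μ : Measure Y} {p : E → Y → ℝ} {P : Measure E}

/-- The density of the channel output when the channel input has law `P`. -/
noncomputable def outputDensity (p : E → Y → ℝ) (P : Measure E) (y : Y) : ℝ≥0∞ :=
  ∫⁻ x, ENNReal.ofReal (p x y) ∂P

theorem IsChannel.measurable_ofReal (hp : IsChannel X μ p) :
    Measurable fun z : E × Y => ENNReal.ofReal (p z.1 z.2) := hp.measurable.ennreal_ofReal

theorem IsChannel.measurable_outputDensity (hp : IsChannel X μ p) [SFinite P] :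
    Measurable (outputDensity p P) := hp.measurable_ofReal.lintegral_prod_left'

theorem IsChannel.measurable_outputDensity_snd (hp : IsChannel X μ p) [SFinite P] :
    Measurable fun z : E × Y => outputDensity p P z.2 :=
  hp.measurable_outputDensity.comp measurable_snd

variable [SigmaFinite μ] [IsProbabilityMeasure P]

theorem IsChannel.fst_jointLaw (hp : IsChannel X μ p) (hP : P Xᶜ = 0) :
    (jointLaw μ p P).fst = P := by
  ext S hS
  rw [Measure.fst_apply hS, jointLaw, withDensity_apply _ (measurable_fst hS),
    ← Set.prod_univ, setLIntegral_prod _ hp.measurable_ofReal.aemeasurable]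
  have hX : ∀ᵐ x ∂P, x ∈ X := mem_ae_iff.2 hP
  have : ∀ᵐ x ∂(P.restrict S), ∫⁻ y in Set.univ, ENNReal.ofReal (p x y) ∂μ = 1 := by
    filter_upwards [ae_restrict_of_ae hX] with x hx
    rw [setLIntegral_univ, hp.lintegral_eq_one x hx]
  rw [lintegral_congr_ae this]
  simp

theorem IsChannel.snd_jointLaw (hp : IsChannel X μ p) :
    (jointLaw μ p P).snd = μ.withDensity (outputDensity p P) := by
  ext S hS
  rw [Measure.snd_apply hS, jointLaw, withDensity_apply _ (measurable_snd hS),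
    withDensity_apply _ hS, ← Set.univ_prod, setLIntegral_prod_symm _
      hp.measurable_ofReal.aemeasurable]
  simp [outputDensity]

theorem IsChannel.isProbabilityMeasure_output (hp : IsChannel X μ p) (hP : P Xᶜ = 0) :
    IsProbabilityMeasure (μ.withDensity (outputDensity p P)) := by
  constructor
  rw [← hp.snd_jointLaw, Measure.snd_univ, ← Measure.fst_univ, hp.fst_jointLaw hP, measure_univ]

omit [SigmaFinite μ] in
theorem IsChannel.outputDensity_pos (hp : IsChannel X μ p) (hP : P Xᶜ = 0) (y : Y) :
    outputDensity p P y ≠ 0 := by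
  have hX : ∀ᵐ x ∂P, x ∈ X := mem_ae_iff.2 hP
  have hm : Measurable fun x => ENNReal.ofReal (p x y) :=
    hp.measurable_ofReal.comp (f := fun x => (x, y)) (by fun_prop)
  intro h0
  have := (lintegral_eq_zero_iff hm).1 h0
  obtain ⟨x, hx, hx'⟩ := (this.and hX).exists
  exact (ENNReal.ofReal_pos.2 (hp.pos x hx' y)).ne' hx

theorem IsChannel.outputDensity_lt_top (hp : IsChannel X μ p) (hP : P Xᶜ = 0) :
    ∀ᵐ y ∂μ, outputDensity p P y < ∞ := by
  refine ae_lt_top hp.measurable_outputDensity ?_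
  have := (hp.isProbabilityMeasure_output hP).measure_univ
  rw [withDensity_apply _ MeasurableSet.univ, setLIntegral_univ] at this
  simp [this]

/-- The density of the joint law of input and output with respect to the product of the
marginals. -/
noncomputable def informationRatio (p : E → Y → ℝ) (P : Measure E) (z : E × Y) : ℝ :=
  p z.1 z.2 / (outputDensity p P z.2).toReal

omit [SigmaFinite μ] in
theorem IsChannel.measurable_informationRatio (hp : IsChannel X μ p) :
    Measurable (informationRatio p P) :=
  hp.measurable.div hp.measurable_outputDensity_snd.ennreal_toReal

omit [SigmaFinite μ] in
theorem IsChannel.prod_output (hp : IsChannel X μ p) [SFinite μ] :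
    P.prod (μ.withDensity (outputDensity p P)) =
      (P.prod μ).withDensity fun z => outputDensity p P z.2 :=
  prod_withDensity_right hp.measurable_outputDensity

theorem IsChannel.outputDensity_mul_informationRatio (hp : IsChannel X μ p) (hP : P Xᶜ = 0) :
    ∀ᵐ z ∂(P.prod μ), outputDensity p P z.2 * ENNReal.ofReal (informationRatio p P z) =
      ENNReal.ofReal (p z.1 z.2) := by
  have h : ∀ᵐ z ∂(P.prod μ), outputDensity p P z.2 < ∞ :=
    Measure.quasiMeasurePreserving_snd.ae (hp.outputDensity_lt_top hP)
  filter_upwards [h] with z hz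
  have h0 := ENNReal.toReal_pos (hp.outputDensity_pos hP z.2) hz.ne
  rw [informationRatio, ENNReal.ofReal_div_of_pos h0, ENNReal.ofReal_toReal hz.ne,
    ENNReal.mul_div_cancel (hp.outputDensity_pos hP z.2) hz.ne]

theorem IsChannel.jointLaw_eq_withDensity (hp : IsChannel X μ p) (hP : P Xᶜ = 0) :
    jointLaw μ p P = (P.prod (μ.withDensity (outputDensity p P))).withDensity
      fun z => ENNReal.ofReal (informationRatio p P z) := by
  rw [hp.prod_output, ← withDensity_mul (P.prod μ) hp.measurable_outputDensity_snd
    hp.measurable_informationRatio.ennreal_ofReal, jointLaw]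
  refine withDensity_congr_ae ?_
  filter_upwards [hp.outputDensity_mul_informationRatio hP] with z hz
  exact hz.symm

theorem IsChannel.klDiv_jointLaw (hp : IsChannel X μ p) (hP : P Xᶜ = 0) :
    klDiv (jointLaw μ p P) ((jointLaw μ p P).fst.prod (jointLaw μ p P).snd) =
      ∫⁻ z, ENNReal.ofReal (klFun (informationRatio p P z))
        ∂(P.prod (μ.withDensity (outputDensity p P))) := by
  have := hp.isProbabilityMeasure_output hP
  have hprob : IsProbabilityMeasure (jointLaw μ p P) := by
    constructor
    rw [← Measure.fst_univ, hp.fst_jointLaw hP, measure_univ]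
  rw [hp.fst_jointLaw hP, hp.snd_jointLaw]
  have hac : jointLaw μ p P ≪ P.prod (μ.withDensity (outputDensity p P)) :=
    hp.jointLaw_eq_withDensity hP ▸ withDensity_absolutelyContinuous _ _
  rw [klDiv_eq_lintegral_klFun_of_ac hac]
  refine lintegral_congr_ae ?_
  have hrn := Measure.rnDeriv_withDensity (P.prod (μ.withDensity (outputDensity p P)))
    (hp.measurable_informationRatio (P := P)).ennreal_ofReal
  rw [← hp.jointLaw_eq_withDensity hP] at hrn
  have hX : ∀ᵐ z ∂(P.prod (μ.withDensity (outputDensity p P))), z.1 ∈ X :=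
    Measure.quasiMeasurePreserving_fst.ae (mem_ae_iff.2 hP)
  filter_upwards [hrn, hX] with z hz hzX
  have h0 : 0 ≤ informationRatio p P z := div_nonneg (hp.pos _ hzX _).le ENNReal.toReal_nonneg
  rw [hz, ENNReal.toReal_ofReal h0]

/-- Gallager's exponent is positive at every rate (in nats) below the mutual information. -/
theorem IsChannel.exists_gallager_lt (hp : IsChannel X μ p) (hP : P Xᶜ = 0) {r : ℝ}
    (hr : ENNReal.ofReal r <
      klDiv (jointLaw μ p P) ((jointLaw μ p P).fst.prod (jointLaw μ p P).snd)) :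
    ∃ s : ℝ, 0 < s ∧ s ≤ 1 ∧ ∫⁻ y, (∫⁻ x, ENNReal.ofReal (p x y) ^ (1 - s) ∂P) *
      (∫⁻ x, ENNReal.ofReal (p x y) ∂P) ^ s ∂μ < ENNReal.ofReal (Real.exp (-(s * r))) := by
  have := hp.isProbabilityMeasure_output hP
  set ν := P.prod (μ.withDensity (outputDensity p P)) with hν
  have hX : ∀ᵐ z ∂ν, z.1 ∈ X := Measure.quasiMeasurePreserving_fst.ae (mem_ae_iff.2 hP)
  have hXμ : ∀ᵐ z ∂(P.prod μ), z.1 ∈ X := Measure.quasiMeasurePreserving_fst.ae (mem_ae_iff.2 hP)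
  have htop : ∀ᵐ z ∂(P.prod μ), outputDensity p P z.2 < ∞ :=
    Measure.quasiMeasurePreserving_snd.ae (hp.outputDensity_lt_top hP)
  have hν_ac : ν ≪ P.prod μ := by
    rw [hν, hp.prod_output]
    exact withDensity_absolutelyContinuous _ _
  -- Off `X` the function `p` may be negative. Truncating at `0` gives the everywhere nonnegative
  -- density that `exists_lintegral_rpow_lt` needs and changes nothing almost everywhere.
  have hmr : Measurable fun z => max (informationRatio p P z) 0 :=
    hp.measurable_informationRatio.max measurable_const
  have hmax : ∀ᵐ z ∂ν, 0 < informationRatio p P z := by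
    filter_upwards [hX, hν_ac.ae_le htop] with z hz hzt
    exact div_pos (hp.pos _ hz _) (ENNReal.toReal_pos (hp.outputDensity_pos hP _) hzt.ne)
  have hint : ∫⁻ z, ENNReal.ofReal (max (informationRatio p P z) 0) ∂ν = 1 := by
    have h1 : (jointLaw μ p P) Set.univ = 1 := by
      rw [← Measure.fst_univ, hp.fst_jointLaw hP, measure_univ]
    rw [hp.jointLaw_eq_withDensity hP, withDensity_apply _ MeasurableSet.univ,
      setLIntegral_univ] at h1
    rw [← h1]
    refine lintegral_congr_ae ?_
    filter_upwards [hmax] with z hz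
    rw [max_eq_left hz.le]
  rw [hp.klDiv_jointLaw hP, ← hν] at hr
  obtain ⟨s, hs0, hs1, hs⟩ := exists_lintegral_rpow_lt hmr (fun z => le_max_right _ _)
    (by filter_upwards [hmax] with z hz using lt_max_of_lt_left hz) hint (r := r) (by
      refine hr.trans_eq (lintegral_congr_ae ?_)
      filter_upwards [hmax] with z hz
      rw [max_eq_left hz.le])
  refine ⟨s, hs0, hs1, lt_of_eq_of_lt ?_ hs⟩
  have hm1 : Measurable fun z : E × Y => ENNReal.ofReal (p z.1 z.2) ^ (1 - s) :=
    hp.measurable_ofReal.pow_const _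
  have hm1x : ∀ y, Measurable fun x => ENNReal.ofReal (p x y) ^ (1 - s) := fun y =>
    hm1.comp (f := fun x => (x, y)) (by fun_prop)
  have hm2 : Measurable fun z : E × Y => outputDensity p P z.2 ^ s :=
    hp.measurable_outputDensity_snd.pow_const s
  calc _ = ∫⁻ y, ∫⁻ x, ENNReal.ofReal (p x y) ^ (1 - s) * outputDensity p P y ^ s ∂P ∂μ := by
        refine lintegral_congr fun y => ?_
        rw [lintegral_mul_const _ (hm1x y)]
        rfl
    _ = ∫⁻ z, ENNReal.ofReal (p z.1 z.2) ^ (1 - s) * outputDensity p P z.2 ^ s ∂(P.prod μ) :=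
        (lintegral_prod_symm _ (hm1.mul hm2).aemeasurable).symm
    -- With `q` the output density, this is `p ^ (1 - s) * q ^ s = q * (p / q) ^ (1 - s)`, and the
    -- leading `q` is absorbed into the product of the marginals.
    _ = ∫⁻ z, outputDensity p P z.2 *
          ENNReal.ofReal (max (informationRatio p P z) 0 ^ (1 - s)) ∂(P.prod μ) := by
        refine lintegral_congr_ae ?_
        filter_upwards [hXμ, htop] with z hz hzt
        have hq0 := hp.outputDensity_pos hP z.2
        have hq := ENNReal.toReal_pos hq0 hzt.ne
        have hpz := hp.pos _ hz z.2
        have hmax : max (informationRatio p P z) 0 = informationRatio p P z :=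
          max_eq_left (div_nonneg hpz.le hq.le)
        rw [hmax, informationRatio,
          ← ENNReal.ofReal_rpow_of_pos (div_pos hpz hq), ENNReal.ofReal_div_of_pos hq,
          ENNReal.ofReal_toReal hzt.ne, ENNReal.div_rpow_of_nonneg _ _ (sub_nonneg.2 hs1),
          div_eq_mul_inv, ← ENNReal.rpow_neg, mul_left_comm]
        congr 1
        nth_rewrite 2 [← ENNReal.rpow_one (outputDensity p P z.2)]
        rw [← ENNReal.rpow_add _ _ hq0 hzt.ne]
        congr 1
        ring
    _ = _ := by
        rw [hν, hp.prod_output]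
        exact (lintegral_withDensity_eq_lintegral_mul _ hp.measurable_outputDensity_snd
          (hmr.pow_const _).ennreal_ofReal).symm

end MutualInformation

/-! ### Codes below capacity and the general channel -/

section Achievability

open Filter Topology InformationTheory

variable {E Y : Type*} [NormedAddCommGroup E] [MeasurableSpace E] [MeasurableSpace Y]
  {X : Set E} {μ : Measure Y} {p : E → Y → ℝ} {v R γ : ℝ≥0}

/-- The strict gap `γ₀ < γ` is what keeps the power constraint satisfied with probability bounded
away from zero in random coding. -/
theorem exists_isInputLaw_of_minSNR_lt (h : minSNR X μ p v R < γ) :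
    ∃ (γ₀ : ℝ≥0) (P : Measure E), γ₀ < γ ∧ IsInputLaw X v γ₀ P ∧ R < mutualInfo μ p P := by
  obtain ⟨a, ⟨γ₀, rfl, hR⟩, hγ⟩ := sInf_lt_iff.1 h
  obtain ⟨P, hP⟩ := lt_iSup_iff.1 hR
  obtain ⟨hP, hRP⟩ := lt_iSup_iff.1 hP
  exact ⟨γ₀, P, by simpa using hγ, hP, hRP⟩

theorem minSNR_lt_of_isInputLaw {γ₀ : ℝ≥0} {P : Measure E} (hγ : γ₀ < γ)
    (hP : IsInputLaw X v γ₀ P) (hR : R < mutualInfo μ p P) : minSNR X μ p v R < γ :=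
  lt_of_le_of_lt (b := (γ₀ : ℝ≥0∞))
    (sInf_le ⟨γ₀, rfl, hR.trans_le (le_iSup₂_of_le P hP le_rfl)⟩) (by simpa using hγ)

/-- Above the minimum required SNR, codes of rate `R` make the loss of the posterior decoder
arbitrarily small. -/
theorem IsChannel.eventually_exists_loss_le [BorelSpace E] [SecondCountableTopology E]
    [SigmaFinite μ] (hX : IsClosed X) (hp : IsChannel X μ p) (hv : v ≠ 0)
    (h : minSNR X μ p v R < γ) {ε : ℝ≥0∞} (hε : 0 < ε) :
    ∃ N : ℕ, ∀ n ≥ N, ∀ M : ℕ, 0 < M → Real.logb 2 M ≤ n * (R : ℝ) →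
      ∃ f : Fin M → Fin n → E, IsEncoder X v γ f ∧ loss μ p f (posteriorDecoder p f) ≤ ε := by
  obtain ⟨γ₀, P, hγ, hP, hR⟩ := exists_isInputLaw_of_minSNR_lt h
  have := hP.isProbabilityMeasure
  have hlog : 0 < Real.log 2 := Real.log_pos one_lt_two
  -- The rate `R` in bits is `R * log 2` in nats.
  obtain ⟨s, hs0, hs1, hs⟩ := hp.exists_gallager_lt (r := R * Real.log 2) hP.support (by
    rw [ENNReal.ofReal_mul R.coe_nonneg, ENNReal.ofReal_coe_nnreal]
    exact (ENNReal.lt_div_iff_mul_lt (Or.inl (ENNReal.ofReal_pos.2 hlog).ne')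
      (Or.inl ENNReal.ofReal_ne_top)).1 hR)
  set I := ∫⁻ y, (∫⁻ x, ENNReal.ofReal (p x y) ^ (1 - s) ∂P) *
      (∫⁻ x, ENNReal.ofReal (p x y) ∂P) ^ s ∂μ
  set C := (1 - (γ₀ / γ : ℝ≥0∞))⁻¹ with hC
  have hCtop : C ≠ ∞ := by
    rw [hC, Ne, ENNReal.inv_eq_top, ← Ne, ← pos_iff_ne_zero, tsub_pos_iff_lt]
    exact ENNReal.div_lt_of_lt_mul (by simpa using hγ)
  set e := ENNReal.ofReal (Real.exp (s * (R * Real.log 2))) with he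
  have hρ : e * I < 1 := by
    have he0 : e ≠ 0 := (ENNReal.ofReal_pos.2 (Real.exp_pos _)).ne'
    have h1 : e * ENNReal.ofReal (Real.exp (-(s * (R * Real.log 2)))) = 1 := by
      rw [he, ← ENNReal.ofReal_mul (Real.exp_pos _).le, ← Real.exp_add, add_neg_cancel,
        Real.exp_zero, ENNReal.ofReal_one]
    rw [← h1]
    exact (ENNReal.mul_lt_mul_iff_right he0 ENNReal.ofReal_ne_top).2 hs
  set K := ENNReal.ofReal s⁻¹ * (C * C ^ s) with hK
  have hKtop : K ≠ ∞ := ENNReal.mul_ne_top ENNReal.ofReal_ne_top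
    (ENNReal.mul_ne_top hCtop (ENNReal.rpow_ne_top_of_nonneg hs0.le hCtop))
  have hlim : Tendsto (fun n : ℕ => K * (e * I) ^ n) atTop (𝓝 0) := by
    simpa using ENNReal.Tendsto.const_mul (ENNReal.tendsto_pow_atTop_nhds_zero_of_lt_one hρ)
      (Or.inr hKtop)
  obtain ⟨N, hN⟩ := eventually_atTop.1 (hlim.eventually_lt_const hε)
  -- Random coding needs at least one channel use.
  refine ⟨max N 1, fun n hn M hM hMR => ?_⟩
  obtain ⟨f, hf, hle⟩ := hp.exists_isEncoder_loss_le hP hX.measurableSet hv hγ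
    (lt_of_lt_of_le zero_lt_one (le_of_max_le_right hn)) hM hs0 hs1
  refine ⟨f, hf, hle.trans (le_trans ?_ (hN n (le_of_max_le_left hn)).le)⟩
  have hM0 : (0 : ℝ) < M := by exact_mod_cast hM
  have hMs : (M : ℝ≥0∞) ^ s ≤ e ^ n := by
    rw [he, ← ENNReal.ofReal_pow (Real.exp_pos _).le, ← Real.exp_nat_mul,
      ← ENNReal.ofReal_natCast, ENNReal.ofReal_rpow_of_pos hM0, Real.rpow_def_of_pos hM0]
    refine ENNReal.ofReal_le_ofReal (Real.exp_le_exp.2 ?_)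
    rw [Real.logb, div_le_iff₀ hlog] at hMR
    nlinarith
  calc _ = ENNReal.ofReal s⁻¹ * (C * ((M : ℝ≥0∞) ^ s * C ^ s)) * I ^ n := by
        rw [ENNReal.mul_rpow_of_nonneg _ _ hs0.le]
    _ ≤ ENNReal.ofReal s⁻¹ * (C * (e ^ n * C ^ s)) * I ^ n := by gcongr
    _ = K * (e * I) ^ n := by rw [hK, mul_pow]; ring

omit [NormedAddCommGroup E] [MeasurableSpace E] in
theorem loss_le_and_errorProb_le {n M : ℕ} (hM : 0 < M) {f : Fin M → Fin n → E}
    {g : (Fin n → Y) → Fin M → ℝ} (hg : Measurable g) {ε : ℝ≥0∞}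
    (h : loss μ p f g ≤ ENNReal.ofReal (Real.log 2) * ε) :
    loss μ p f g ≤ ε ∧ errorProb μ p f g ≤ ε := by
  have hlog : 0 < Real.log 2 := Real.log_pos one_lt_two
  constructor
  · refine h.trans ?_
    calc _ ≤ 1 * ε := by
          gcongr
          rw [ENNReal.ofReal_le_one]
          exact (Real.log_le_sub_one_of_pos two_pos).trans (by norm_num)
      _ = ε := one_mul ε
  · exact (ENNReal.mul_le_mul_iff_right (ENNReal.ofReal_pos.2 hlog).ne' ENNReal.ofReal_ne_top).1
      ((log_two_mul_errorProb_le_loss hM f hg).trans h)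

theorem IsChannel.exists_isGlobalMin_of_minSNR_lt [NormedSpace ℝ E] [FiniteDimensional ℝ E]
    [BorelSpace E] (hX : IsClosed X) (hp : IsChannel X μ p) (h : minSNR X μ p v R < γ)
    {n M : ℕ} (hM : 0 < M) :
    ∃ (f : Fin M → Fin n → E) (g : (Fin n → Y) → Fin M → ℝ), IsGlobalMin X μ p v γ f g := by
  obtain ⟨γ₀, P, hγ, hP, -⟩ := exists_isInputLaw_of_minSNR_lt h
  have := hP.isProbabilityMeasure
  -- Some letter of `X` has power at most the mean power of `P`. The encoder repeating it is
  -- admissible, so the minimization is over a nonempty set.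
  obtain ⟨x, hx, hle⟩ := exists_notMem_null_le_lintegral (f := fun x : E => ‖x‖ₑ ^ 2) (μ := P)
    (by fun_prop) hP.support
  obtain ⟨f, hf⟩ := hp.exists_isGlobalMin (n := n) (v := v) (γ := γ) hX hM
    (x := x) (by simpa using hx) (by
      have h1 : ‖x‖ₑ ^ 2 ≤ ((γ * v : ℝ≥0) : ℝ≥0∞) := (hle.trans hP.power).trans (by gcongr)
      have h2 := ENNReal.toReal_mono ENNReal.coe_ne_top h1
      simpa using h2)
  exact ⟨f, _, hf⟩

theorem IsChannel.eventually_isGlobalMin_le [BorelSpace E] [SecondCountableTopology E]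
    [SigmaFinite μ] (hX : IsClosed X) (hp : IsChannel X μ p) (hv : v ≠ 0)
    (h : minSNR X μ p v R < γ) {ε : ℝ≥0∞} (hε : 0 < ε) :
    ∃ N : ℕ, ∀ n ≥ N, ∀ M : ℕ, 0 < M → Real.logb 2 M ≤ n * (R : ℝ) →
      ∀ (f : Fin M → Fin n → E) (g : (Fin n → Y) → Fin M → ℝ), IsGlobalMin X μ p v γ f g →
        loss μ p f g ≤ ε ∧ errorProb μ p f g ≤ ε := by
  -- The target is `log 2 * ε` because passing from loss to error probability divides by `log 2`; as
  -- `log 2 ≤ 1`, the loss is still at most `ε`.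
  obtain ⟨N, hN⟩ := hp.eventually_exists_loss_le hX hv h
    (ε := ENNReal.ofReal (Real.log 2) * ε)
    (ENNReal.mul_pos (ENNReal.ofReal_pos.2 (Real.log_pos one_lt_two)).ne' hε.ne')
  refine ⟨N, fun n hn M hM hMR f g hfg => ?_⟩
  obtain ⟨f', hf', hle⟩ := hN n hn M hM hMR
  exact loss_le_and_errorProb_le hM hfg.decoder
    ((hfg.le f' _ hf' (hp.measurable_posteriorDecoder f')).trans hle)

end Achievability

/-! ### The Gaussian tail and monotonicity of the one-bit capacity -/

section GaussianTail

theorem gaussianPDFReal_zero_one (s : ℝ) :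
    gaussianPDFReal 0 1 s = 1 / √(2 * Real.pi) * Real.exp (-s ^ 2 / 2) := by
  simp [gaussianPDFReal]

theorem Q_eq_setIntegral_gaussianPDFReal (t : ℝ) :
    Q t = ∫ s in Set.Ioi t, gaussianPDFReal 0 1 s := by
  simp [Q, gaussianPDFReal_zero_one]

theorem Q_eq_gaussianReal (t : ℝ) : Q t = (gaussianReal 0 1).real (Set.Ioi t) := by
  rw [Q_eq_setIntegral_gaussianPDFReal, Measure.real, gaussianReal_apply_eq_integral _ one_ne_zero,
    ENNReal.toReal_ofReal (integral_nonneg fun s => gaussianPDFReal_nonneg _ _ s)]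

theorem continuous_Q : Continuous Q := by
  have hint : Integrable (gaussianPDFReal 0 1) := integrable_gaussianPDFReal 0 1
  have : Q = fun t => Q 0 - ∫ s in (0 : ℝ)..t, gaussianPDFReal 0 1 s := by
    ext t
    rw [Q_eq_setIntegral_gaussianPDFReal, Q_eq_setIntegral_gaussianPDFReal,
      ← intervalIntegral.integral_interval_add_Ioi (a := 0) (b := t) hint.integrableOn
        hint.integrableOn]
    ring
  rw [this]
  exact continuous_const.sub (hint.continuous_primitive 0)

theorem gaussianReal_real_pos {v : ℝ≥0} (hv : v ≠ 0) {S : Set ℝ} (hS : volume S ≠ 0) :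
    0 < (gaussianReal 0 v).real S := by
  rw [measureReal_def]
  refine ENNReal.toReal_pos (fun h => hS ?_) (measure_ne_top _ _)
  exact gaussianReal_absolutelyContinuous' 0 hv h

theorem strictAnti_Q : StrictAnti Q := by
  intro a b hab
  have h : (gaussianReal 0 1).real (Set.Ioi a) =
      (gaussianReal 0 1).real (Set.Ioc a b) + (gaussianReal 0 1).real (Set.Ioi b) := by
    rw [← Set.Ioc_union_Ioi_eq_Ioi hab.le, measureReal_union (Set.Ioc_disjoint_Ioi le_rfl)
      measurableSet_Ioi]
  have hpos : 0 < (gaussianReal 0 1).real (Set.Ioc a b) :=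
    gaussianReal_real_pos one_ne_zero (by simpa using hab)
  rw [Q_eq_gaussianReal, Q_eq_gaussianReal, h]
  linarith

theorem gaussianReal_real_preimage_neg (v : ℝ≥0) {S : Set ℝ} (hS : MeasurableSet S) :
    (gaussianReal 0 v).real ((fun x => -x) ⁻¹' S) = (gaussianReal 0 v).real S := by
  have h := gaussianReal_map_neg (μ := 0) (v := v)
  rw [neg_zero] at h
  conv_rhs => rw [← h]
  exact (map_measureReal_apply measurable_neg hS).symm

theorem gaussianReal_map_sqrt_mul (v : ℝ≥0) :
    (gaussianReal 0 1).map (fun z => √(v : ℝ) * z) = gaussianReal 0 v := by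
  rw [gaussianReal_map_const_mul]
  congr 1
  · simp
  · ext; simp

theorem Q_neg (t : ℝ) : Q (-t) = 1 - Q t := by
  have := nullSingletonClass_gaussianReal (μ := 0) one_ne_zero
  have h := gaussianReal_real_preimage_neg 1 (measurableSet_Ioi (a := -t))
  rw [Q_eq_gaussianReal, Q_eq_gaussianReal, ← h, ← probReal_compl_eq_one_sub measurableSet_Ioi]
  have : (fun x : ℝ => -x) ⁻¹' Set.Ioi (-t) = Set.Iio t := by ext; simp
  rw [this, Set.compl_Ioi, measureReal_congr Iio_ae_eq_Iic]

theorem Q_zero : Q 0 = 2⁻¹ := by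
  have := Q_neg 0
  rw [neg_zero] at this
  linarith

theorem Q_pos (t : ℝ) : 0 < Q t := by
  rw [Q_eq_gaussianReal]
  exact gaussianReal_real_pos one_ne_zero (by simp)

theorem Q_lt_one (t : ℝ) : Q t < 1 := by
  have := Q_pos (-t)
  rw [Q_neg] at this
  linarith

theorem binEntropy_Q_abs (t : ℝ) : Real.binEntropy (Q |t|) = Real.binEntropy (Q t) := by
  rcases abs_choice t with h | h <;> rw [h]
  rw [Q_neg, Real.binEntropy_one_sub]

/-- The entropy of the sign of a noisy real number decreases with its absolute value. -/
theorem binEntropy_Q_lt {a b : ℝ} (h : |a| < |b|) :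
    Real.binEntropy (Q b) < Real.binEntropy (Q a) := by
  rw [← binEntropy_Q_abs a, ← binEntropy_Q_abs b]
  have hle : ∀ t : ℝ, Q |t| ≤ 2⁻¹ := fun t => Q_zero ▸ strictAnti_Q.antitone (abs_nonneg t)
  exact Real.binEntropy_strictMonoOn ⟨(Q_pos _).le, hle b⟩ ⟨(Q_pos _).le, hle a⟩ (strictAnti_Q h)

theorem integrable_binEntropy_Q (P : Measure ℝ) [IsProbabilityMeasure P] (c : ℝ) :
    Integrable (fun t => Real.binEntropy (Q (t * c))) P := by
  refine (integrable_const (Real.log 2)).mono' (Continuous.aestronglyMeasurable ?_)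
    (Filter.Eventually.of_forall fun t => ?_)
  · exact Real.binEntropy_continuous.comp (continuous_Q.comp (by fun_prop))
  · rw [Real.norm_of_nonneg (Real.binEntropy_nonneg (Q_pos _).le (Q_lt_one _).le)]
    exact Real.binEntropy_le_log_two

theorem log_two_mul_oneBitCapacity (γ : ℝ≥0) : Real.log 2 * oneBitCapacity γ =
    ∫ t, (Real.log 2 - Real.binEntropy (Q (t * √(γ : ℝ)))) ∂(gaussianReal 0 1) := by
  rw [oneBitCapacity, ← integral_const_mul]
  refine integral_congr_ae (Filter.Eventually.of_forall fun t => ?_)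
  have hlog : Real.log 2 ≠ 0 := (Real.log_pos one_lt_two).ne'
  simp only [Real.binEntropy, Real.log_inv, Real.logb]
  field_simp
  ring

/-- A larger SNR increases `|t * √γ|` for every `t ≠ 0` and so lowers the binary entropy strictly.
Equality occurs only at `t = 0`, a null set. -/
theorem strictMono_oneBitCapacity : StrictMono oneBitCapacity := by
  intro a b hab
  have hlog : 0 < Real.log 2 := Real.log_pos one_lt_two
  refine lt_of_mul_lt_mul_left ?_ hlog.le
  have hia := integrable_binEntropy_Q (gaussianReal 0 1) √(a : ℝ)
  have hib := integrable_binEntropy_Q (gaussianReal 0 1) √(b : ℝ)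
  rw [log_two_mul_oneBitCapacity, log_two_mul_oneBitCapacity, integral_sub (integrable_const _) hia,
    integral_sub (integrable_const _) hib]
  refine sub_lt_sub_left (sub_pos.1 ?_) _
  have hlt : ∀ t : ℝ, t ≠ 0 → Real.binEntropy (Q (t * √(b : ℝ))) <
      Real.binEntropy (Q (t * √(a : ℝ))) := fun t ht => by
    refine binEntropy_Q_lt ?_
    rw [abs_mul, abs_mul, abs_of_nonneg (Real.sqrt_nonneg _), abs_of_nonneg (Real.sqrt_nonneg _)]
    have : √(a : ℝ) < √(b : ℝ) := Real.sqrt_lt_sqrt a.coe_nonneg hab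
    have := abs_pos.2 ht
    gcongr
  rw [← integral_sub hia hib]
  refine (integral_pos_iff_support_of_nonneg ?_ (hia.sub hib)).2 ?_
  rotate_left
  · have := nullSingletonClass_gaussianReal (μ := 0) one_ne_zero
    have h1 : (gaussianReal 0 1) {(0 : ℝ)}ᶜ = 1 := by
      rw [prob_compl_eq_one_iff (measurableSet_singleton 0)]
      exact measure_singleton 0
    refine lt_of_lt_of_le (h1 ▸ zero_lt_one) (measure_mono fun t ht => ?_)
    exact (sub_pos.2 (hlt t ht)).ne'
  · intro t
    rcases eq_or_ne t 0 with rfl | ht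
    · simp
    · exact (sub_pos.2 (hlt t ht)).le

theorem oneBitCapacity_nonneg (γ : ℝ≥0) : 0 ≤ oneBitCapacity γ := by
  have hlog : 0 < Real.log 2 := Real.log_pos one_lt_two
  refine nonneg_of_mul_nonneg_right ?_ hlog
  rw [log_two_mul_oneBitCapacity]
  exact integral_nonneg fun t => sub_nonneg.2 Real.binEntropy_le_log_two

end GaussianTail

/-! ### The one-bit quantized Gaussian channel -/

section OneBitChannel

open InformationTheory

variable {v : ℝ≥0}

theorem measurable_oneBit : Measurable oneBit :=
  measurable_to_bool (by
    have : oneBit ⁻¹' {true} = Set.Ici 0 := by ext; simp [oneBit]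
    exact this ▸ measurableSet_Ici)

theorem oneBitChannel_false (hv : v ≠ 0) (x : ℝ) :
    oneBitChannel v x false = Q (x / √(v : ℝ)) := by
  have hσ : 0 < √(v : ℝ) := Real.sqrt_pos.2 (by positivity)
  have hset : (fun z => oneBit (x + z)) ⁻¹' {false} = Set.Iio (-x) := by
    ext z; simp [oneBit, lt_neg_iff_add_neg']
  have hm : Measurable fun z => oneBit (x + z) := measurable_oneBit.comp (by fun_prop)
  rw [oneBitChannel, map_measureReal_apply hm (measurableSet_singleton _), hset, ← gaussianReal_real_preimage_neg v measurableSet_Iio,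
    ← gaussianReal_map_sqrt_mul, map_measureReal_apply (by fun_prop) (measurable_neg measurableSet_Iio),
    Q_eq_gaussianReal]
  congr 1
  ext z
  simp [div_lt_iff₀' hσ]

theorem oneBitChannel_true (hv : v ≠ 0) (x : ℝ) :
    oneBitChannel v x true = 1 - Q (x / √(v : ℝ)) := by
  have hm : Measurable fun z => oneBit (x + z) := measurable_oneBit.comp (by fun_prop)
  have : IsProbabilityMeasure ((gaussianReal 0 v).map fun z => oneBit (x + z)) :=
    Measure.isProbabilityMeasure_map hm.aemeasurable
  rw [← oneBitChannel_false hv, oneBitChannel, oneBitChannel,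
    ← probReal_compl_eq_one_sub (measurableSet_singleton _)]
  congr 1
  ext b
  cases b <;> simp

theorem oneBitChannel_true_eq_neg (hv : v ≠ 0) (x : ℝ) :
    oneBitChannel v x true = oneBitChannel v (-x) false := by
  rw [oneBitChannel_true hv, oneBitChannel_false hv, neg_div, Q_neg]

theorem continuous_oneBitChannel (hv : v ≠ 0) (b : Bool) :
    Continuous fun x => oneBitChannel v x b := by
  cases b
  · simp only [oneBitChannel_false hv]
    exact continuous_Q.comp (by fun_prop)
  · simp only [oneBitChannel_true hv]
    exact continuous_const.sub (continuous_Q.comp (by fun_prop))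

theorem oneBitChannel_pos (hv : v ≠ 0) (x : ℝ) (b : Bool) : 0 < oneBitChannel v x b := by
  cases b
  · rw [oneBitChannel_false hv]
    exact Q_pos _
  · rw [oneBitChannel_true hv]
    exact sub_pos.2 (Q_lt_one _)

theorem oneBitChannel_true_add_false (hv : v ≠ 0) (x : ℝ) :
    ENNReal.ofReal (oneBitChannel v x true) + ENNReal.ofReal (oneBitChannel v x false) = 1 := by
  rw [← ENNReal.ofReal_add (oneBitChannel_pos hv _ _).le (oneBitChannel_pos hv _ _).le,
    oneBitChannel_true hv, oneBitChannel_false hv, sub_add_cancel, ENNReal.ofReal_one]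

theorem isChannel_oneBitChannel (hv : v ≠ 0) :
    IsChannel Set.univ (Measure.count : Measure Bool) (oneBitChannel v) where
  measurable := measurable_from_prod_countable_left fun b => (continuous_oneBitChannel hv b).measurable
  pos x _ b := oneBitChannel_pos hv x b
  lintegral_eq_one x _ := by
    rw [lintegral_count, tsum_fintype, Fintype.sum_bool, oneBitChannel_true_add_false hv]
  continuousOn b := (continuous_oneBitChannel hv b).continuousOn

theorem isInputLaw_gaussianReal (γ : ℝ≥0) :
    IsInputLaw Set.univ v γ (gaussianReal 0 (γ * v)) where
  isProbabilityMeasure := inferInstance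
  support := by simp
  power := by
    have h := evariance_eq_lintegral_ofReal (X := fun x : ℝ => x) (μ := gaussianReal 0 (γ * v))
    have hL : MemLp (fun x : ℝ => x) 2 (gaussianReal 0 (γ * v)) := memLp_id_gaussianReal 2
    rw [← hL.ofReal_variance_eq, variance_fun_id_gaussianReal] at h
    simp only [integral_id_gaussianReal, sub_zero] at h
    rw [← ENNReal.ofReal_coe_nnreal, h]
    refine (lintegral_congr fun x => ?_).le
    rw [← ofReal_norm, ← ENNReal.ofReal_pow (norm_nonneg _), Real.norm_eq_abs, sq_abs]

/-- Negating the input exchanges the two outputs and preserves the centred Gaussian law, so both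
outputs are equally likely. -/
theorem outputDensity_oneBitChannel (hv : v ≠ 0) (w : ℝ≥0) (b : Bool) :
    outputDensity (oneBitChannel v) (gaussianReal 0 w) b = 2⁻¹ := by
  have hm : ∀ b, Measurable fun x => ENNReal.ofReal (oneBitChannel v x b) := fun b =>
    (continuous_oneBitChannel hv b).measurable.ennreal_ofReal
  have hsymm : outputDensity (oneBitChannel v) (gaussianReal 0 w) true =
      outputDensity (oneBitChannel v) (gaussianReal 0 w) false := by
    have h := gaussianReal_map_neg (μ := 0) (v := w)
    rw [neg_zero] at h
    unfold outputDensity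
    simp only [oneBitChannel_true_eq_neg hv]
    conv_rhs => rw [← h]
    rw [lintegral_map (hm false) measurable_neg]
  have hsum : outputDensity (oneBitChannel v) (gaussianReal 0 w) true +
      outputDensity (oneBitChannel v) (gaussianReal 0 w) false = 1 := by
    unfold outputDensity
    rw [← lintegral_add_left (hm true)]
    simp [oneBitChannel_true_add_false hv]
  have hfalse : outputDensity (oneBitChannel v) (gaussianReal 0 w) false = 2⁻¹ := by
    rw [hsymm, ← two_mul, mul_comm] at hsum
    exact ENNReal.eq_inv_of_mul_eq_one_left hsum
  cases b
  · exact hfalse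
  · exact hsymm.trans hfalse

/-- The divergence of a Bernoulli law from the uniform one: relative to output probabilities `1 /
2`, the density is twice the transition probability. -/
theorem sum_klFun_two_mul (q : ℝ) (hq : 0 < q) (hq1 : q < 1) :
    2⁻¹ * klFun (2 * (1 - q)) + 2⁻¹ * klFun (2 * q) = Real.log 2 - Real.binEntropy q := by
  have h1 : 0 < 1 - q := sub_pos.2 hq1
  rw [klFun_apply, klFun_apply, Real.log_mul two_ne_zero h1.ne', Real.log_mul two_ne_zero hq.ne',
    Real.binEntropy, Real.log_inv, Real.log_inv]
  ring

/-- With Gaussian inputs, the mutual information of the one-bit quantized channel is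
`oneBitCapacity`. -/
theorem mutualInfo_oneBitChannel (hv : v ≠ 0) (γ : ℝ≥0) :
    mutualInfo Measure.count (oneBitChannel v) (gaussianReal 0 (γ * v)) =
      ENNReal.ofReal (oneBitCapacity γ) := by
  have hp := isChannel_oneBitChannel hv
  have hlog : 0 < Real.log 2 := Real.log_pos one_lt_two
  have hσ : 0 < √(v : ℝ) := Real.sqrt_pos.2 (by positivity)
  have hsupp := (isInputLaw_gaussianReal (v := v) γ).support
  have hr : ∀ x b, informationRatio (oneBitChannel v) (gaussianReal 0 (γ * v)) (x, b) =
      2 * oneBitChannel v x b := fun x b => by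
    rw [informationRatio, outputDensity_oneBitChannel hv]
    simp [mul_comm]
  have hkl : Measurable fun z : ℝ × Bool => ENNReal.ofReal
      (klFun (informationRatio (oneBitChannel v) (gaussianReal 0 (γ * v)) z)) :=
    (measurable_klFun.comp hp.measurable_informationRatio).ennreal_ofReal
  have hH : Measurable fun x => ENNReal.ofReal
      (Real.log 2 - Real.binEntropy (Q (x / √(v : ℝ)))) := by
    refine Continuous.measurable (ENNReal.continuous_ofReal.comp (continuous_const.sub ?_))
    exact Real.binEntropy_continuous.comp (continuous_Q.comp (by fun_prop))
  rw [mutualInfo, hp.klDiv_jointLaw hsupp,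
    ← ENNReal.mul_div_cancel_right (a := ENNReal.ofReal (oneBitCapacity γ))
      (ENNReal.ofReal_pos.2 hlog).ne' ENNReal.ofReal_ne_top,
    mul_comm (ENNReal.ofReal _) (ENNReal.ofReal _), ← ENNReal.ofReal_mul hlog.le, log_two_mul_oneBitCapacity]
  congr 1
  calc _ = ∫⁻ z, 2⁻¹ * ENNReal.ofReal
          (klFun (informationRatio (oneBitChannel v) (gaussianReal 0 (γ * v)) z))
          ∂((gaussianReal 0 (γ * v)).prod Measure.count) := by
        rw [hp.prod_output, lintegral_withDensity_eq_lintegral_mul _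
          hp.measurable_outputDensity_snd hkl]
        simp [outputDensity_oneBitChannel hv]
    _ = ∫⁻ x, ENNReal.ofReal (Real.log 2 - Real.binEntropy (Q (x / √(v : ℝ))))
          ∂(gaussianReal 0 (γ * v)) := by
        rw [lintegral_prod _ (hkl.const_mul _).aemeasurable]
        refine lintegral_congr fun x => ?_
        rw [lintegral_count, tsum_fintype, Fintype.sum_bool, hr, hr, oneBitChannel_true hv,
          oneBitChannel_false hv, ← sum_klFun_two_mul _ (Q_pos _) (Q_lt_one _)]
        have h2 : (2⁻¹ : ℝ≥0∞) = ENNReal.ofReal 2⁻¹ := by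
          rw [ENNReal.ofReal_inv_of_pos two_pos, ENNReal.ofReal_ofNat]
        have hq := (Q_pos (x / √(v : ℝ))).le
        have hq1 := sub_nonneg.2 (Q_lt_one (x / √(v : ℝ))).le
        have hk1 := klFun_nonneg (mul_nonneg two_pos.le hq)
        have hk2 := klFun_nonneg (mul_nonneg two_pos.le hq1)
        rw [ENNReal.ofReal_add (by positivity) (by positivity), ENNReal.ofReal_mul (by positivity),
          ENNReal.ofReal_mul (by positivity), h2]
    _ = ∫⁻ t, ENNReal.ofReal (Real.log 2 - Real.binEntropy (Q (t * √(γ : ℝ))))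
          ∂(gaussianReal 0 1) := by
        rw [← gaussianReal_map_sqrt_mul, lintegral_map hH (by fun_prop)]
        refine lintegral_congr fun t => ?_
        rw [NNReal.coe_mul, Real.sqrt_mul γ.coe_nonneg, mul_assoc, mul_comm √(v : ℝ), ← mul_assoc,
          mul_div_cancel_right₀ _ hσ.ne', mul_comm]
    _ = _ := (ofReal_integral_eq_lintegral_ofReal
        ((integrable_const _).sub (integrable_binEntropy_Q _ _))
        (Filter.Eventually.of_forall fun t => sub_nonneg.2 Real.binEntropy_le_log_two)).symm

/-- The minimum required SNR of the one-bit quantized channel is at most the SNR at which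
`oneBitCapacity` reaches the rate. -/
theorem minSNR_oneBitChannel_lt (hv : v ≠ 0) {γ₀ γ R : ℝ≥0} (h : oneBitCapacity γ₀ = R)
    (hγ : γ₀ < γ) : minSNR Set.univ Measure.count (oneBitChannel v) v R < γ := by
  -- At `γ₀` the capacity only equals `R`. An intermediate SNR exceeds `R` strictly while staying
  -- below `γ`.
  obtain ⟨γ₁, h01, h1⟩ := exists_between hγ
  refine minSNR_lt_of_isInputLaw h1 (isInputLaw_gaussianReal γ₁) ?_
  rw [mutualInfo_oneBitChannel hv, ← ENNReal.ofReal_coe_nnreal, ← h]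
  exact (ENNReal.ofReal_lt_ofReal_iff_of_nonneg (oneBitCapacity_nonneg _)).2
    (strictMono_oneBitCapacity h01)

end OneBitChannel

/-! ### Networks realizing the posterior decoder -/

section Network

variable {n M w : ℕ} {v γ : ℝ≥0} {φ : ℝ → ℝ}

theorem linearEncoder_apply (θ : Matrix (Fin n) (Fin M) ℝ) (m : Fin M) (j : Fin n) :
    linearEncoder θ m j = θ j m := by
  simp [linearEncoder]

theorem linearEncoder_of (f : Fin M → Fin n → ℝ) :
    linearEncoder (Matrix.of fun j m => f m j) = f := by
  ext m j
  rw [linearEncoder_apply, Matrix.of_apply]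

/-- A network with a hidden layer of width at least `n` and a non-constant activation function
represents every function that is a sum of functions of the single input bits. -/
theorem exists_decoderNet_eq_sum (hw : n ≤ w) (hφ : ∃ s t, φ s ≠ φ t)
    (h : Fin M → Fin n → Bool → ℝ) :
    ∃ θ : DecoderParams n w M, ∀ r m, decoderNet φ θ r m = ∑ j, h m j (r j) := by
  obtain ⟨s, t, hst⟩ := hφ
  have hst' : φ s - φ t ≠ 0 := sub_ne_zero.2 hst
  let e : Fin n → Fin w := Fin.castLE hw
  have he : Function.Injective e := Fin.castLE_injective hw
  let A : Fin M → Fin n → ℝ := fun m j => (h m j true - h m j false) / (φ s - φ t)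
  -- Hidden unit `e j` sees only bit `j`, mapped affinely so that `+1` goes to `s` and `-1` to `t`.
  -- Since `φ s ≠ φ t`, any function of the bit is affine in the unit's output, with slope `A m j`;
  -- the units outside the range of `e` get output weight zero.
  refine ⟨⟨Matrix.of fun i j => if e j = i then (s - t) / 2 else 0, fun _ => (s + t) / 2,
    Matrix.of fun m i => ∑ j, if e j = i then A m j else 0,
    fun m => ∑ j, (h m j true - A m j * φ s)⟩, fun r m => ?_⟩
  have hbit : ∀ b : Bool, φ ((s - t) / 2 * bitValue b + (s + t) / 2) = if b then φ s else φ t := by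
    intro b
    cases b
    · simp only [bitValue, Bool.false_eq_true, if_false]
      congr 1
      ring
    · simp only [bitValue, if_true]
      congr 1
      ring
  have hval : ∀ j (b : Bool), A m j * (if b then φ s else φ t) + (h m j true - A m j * φ s) =
      h m j b := by
    intro j b
    cases b
    · have : A m j * (φ s - φ t) = h m j true - h m j false := div_mul_cancel₀ _ hst'
      simp only [Bool.false_eq_true, if_false]
      linarith
    · simp
  simp only [decoderNet, Pi.add_apply, Matrix.mulVec, dotProduct, Matrix.of_apply, Finset.sum_mul]
  rw [Finset.sum_comm, ← Finset.sum_add_distrib]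
  refine Finset.sum_congr rfl fun j _ => ?_
  rw [← hval j (r j), ← hbit (r j)]
  congr 1
  simp [he.eq_iff]

theorem exists_decoderNet_eq_posteriorDecoder (hv : v ≠ 0) (hw : n ≤ w) (hφ : ∃ s t, φ s ≠ φ t)
    (f : Fin M → Fin n → ℝ) :
    ∃ θ : DecoderParams n w M, decoderNet φ θ = posteriorDecoder (oneBitChannel v) f := by
  obtain ⟨θ, hθ⟩ := exists_decoderNet_eq_sum hw hφ
    fun m j b => Real.log (oneBitChannel v (f m j) b)
  refine ⟨θ, ?_⟩
  ext r m
  rw [hθ, posteriorDecoder, likelihood,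
    Real.log_prod fun j _ => (oneBitChannel_pos hv (f m j) (r j)).ne']

theorem measurable_decoderNet (θ : DecoderParams n w M) : Measurable (decoderNet φ θ) :=
  Measurable.of_discrete

/-- A minimizer over all measurable decoders can be taken with the posterior decoder, which is a
network; it is therefore also a minimizer among networks. -/
theorem exists_isOneBitGlobalMin (hv : v ≠ 0) (hM : 0 < M) (hw : n ≤ w)
    (hφ : ∃ s t, φ s ≠ φ t) :
    ∃ (θf : Matrix (Fin n) (Fin M) ℝ) (θg : DecoderParams n w M),
      IsOneBitGlobalMin φ v γ θf θg := by
  obtain ⟨f, hf⟩ := (isChannel_oneBitChannel hv).exists_isGlobalMin (n := n) (v := v) (γ := γ)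
    isClosed_univ hM (Set.mem_univ (0 : ℝ)) (by simp; positivity)
  obtain ⟨θg, hθg⟩ := exists_decoderNet_eq_posteriorDecoder hv hw hφ f
  refine ⟨Matrix.of fun j m => f m j, θg, ?_, fun θf' θg' hθf' => ?_⟩
  · rw [linearEncoder_of]
    exact hf.encoder
  · rw [oneBitLoss, linearEncoder_of, hθg]
    exact hf.le _ _ hθf' (measurable_decoderNet θg')

theorem eventually_isOneBitGlobalMin_le (hv : v ≠ 0) {R γ₀ : ℝ≥0} (h : oneBitCapacity γ₀ = R)
    (hγ : γ₀ < γ) {ε : ℝ≥0∞} (hε : 0 < ε) :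
    ∃ N : ℕ, ∀ n ≥ N, ∀ M w : ℕ, 0 < M → Real.logb 2 M ≤ n * (R : ℝ) → n ≤ w →
      ∀ φ : ℝ → ℝ, (∃ s t, φ s ≠ φ t) →
      ∀ (θf : Matrix (Fin n) (Fin M) ℝ) (θg : DecoderParams n w M),
        IsOneBitGlobalMin φ v γ θf θg →
          oneBitLoss φ v θf θg ≤ ε ∧ oneBitErrorProb φ v θf θg ≤ ε := by
  -- `N` comes from the channel alone, before `w` and `φ` are chosen, hence the uniformity in both.
  obtain ⟨N, hN⟩ := (isChannel_oneBitChannel hv).eventually_exists_loss_le isClosed_univ hv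
    (minSNR_oneBitChannel_lt hv h hγ) (ε := ENNReal.ofReal (Real.log 2) * ε)
    (ENNReal.mul_pos (ENNReal.ofReal_pos.2 (Real.log_pos one_lt_two)).ne' hε.ne')
  refine ⟨N, fun n hn M w hM hMR hw φ hφ θf θg hmin => ?_⟩
  obtain ⟨f, hf, hle⟩ := hN n hn M hM hMR
  obtain ⟨θg', hθg'⟩ := exists_decoderNet_eq_posteriorDecoder hv hw hφ f
  refine loss_le_and_errorProb_le hM (measurable_decoderNet θg) ?_
  refine (hmin.le (Matrix.of fun j m => f m j) θg' (by rwa [linearEncoder_of])).trans ?_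
  rwa [oneBitLoss, linearEncoder_of, hθg']

end Network

end ChannelAE

theorem theorem2
    {E Y : Type*} [NormedAddCommGroup E] [NormedSpace ℝ E] [FiniteDimensional ℝ E]
    [MeasurableSpace E] [BorelSpace E] [MeasurableSpace Y] :
    -- every memoryless channel, arbitrary decoders
    (∀ (X : Set E) (μ : Measure Y) [SigmaFinite μ] (p : E → Y → ℝ) (v R γ : ℝ≥0),
      IsClosed X → ChannelAE.IsChannel X μ p → v ≠ 0 → ChannelAE.minSNR X μ p v R < γ →
      (∀ n M : ℕ, 0 < M →
        ∃ (f : Fin M → Fin n → E) (g : (Fin n → Y) → Fin M → ℝ),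
          ChannelAE.IsGlobalMin X μ p v γ f g) ∧
      (∀ ε : ℝ≥0∞, 0 < ε → ∃ N : ℕ, ∀ n ≥ N, ∀ M : ℕ, 0 < M → Real.logb 2 M ≤ n * (R : ℝ) →
        ∀ (f : Fin M → Fin n → E) (g : (Fin n → Y) → Fin M → ℝ),
          ChannelAE.IsGlobalMin X μ p v γ f g →
            ChannelAE.loss μ p f g ≤ ε ∧ ChannelAE.errorProb μ p f g ≤ ε)) ∧
    -- the one-bit quantized AWGN channel, neural network decoders of a fixed width
    (∀ (v γ γmin : ℝ≥0) (R : ℝ),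
      v ≠ 0 → IsLeast {a : ℝ≥0 | ChannelAE.oneBitCapacity a = R} γmin → γmin < γ →
      (∀ n M w : ℕ, 0 < M → n ≤ w → ∀ φ : ℝ → ℝ, (∃ s t, φ s ≠ φ t) →
        ∃ (θf : Matrix (Fin n) (Fin M) ℝ) (θg : ChannelAE.DecoderParams n w M),
          ChannelAE.IsOneBitGlobalMin φ v γ θf θg) ∧
      (∀ ε : ℝ≥0∞, 0 < ε → ∃ N : ℕ, ∀ n ≥ N, ∀ M w : ℕ, 0 < M → Real.logb 2 M ≤ n * R →
        n ≤ w → ∀ φ : ℝ → ℝ, (∃ s t, φ s ≠ φ t) →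
        ∀ (θf : Matrix (Fin n) (Fin M) ℝ) (θg : ChannelAE.DecoderParams n w M),
          ChannelAE.IsOneBitGlobalMin φ v γ θf θg →
            ChannelAE.oneBitLoss φ v θf θg ≤ ε ∧ ChannelAE.oneBitErrorProb φ v θf θg ≤ ε)) := by
  refine ⟨fun X μ _ p v R γ hX hp hv h =>
      ⟨fun n M hM => hp.exists_isGlobalMin_of_minSNR_lt hX h hM, fun ε hε => ?_⟩,
    fun v γ γmin R hv hmin hγ => ⟨fun n M w hM hw φ hφ =>
      ChannelAE.exists_isOneBitGlobalMin hv hM hw hφ, fun ε hε => ?_⟩⟩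
  · have : ProperSpace E := FiniteDimensional.proper ℝ E
    exact hp.eventually_isGlobalMin_le hX hv h hε
  · have hR : ChannelAE.oneBitCapacity γmin = R := hmin.1
    lift R to ℝ≥0 using hR ▸ ChannelAE.oneBitCapacity_nonneg γmin
    exact ChannelAE.eventually_isOneBitGlobalMin_le hv hR hγ hε
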